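/- Let $A$ be a non-zero finite dimensional algebra over a field $k$, let $\mathrm{mod}(A)$ be the category of finitely generated left $A$-modules, and let $\tau$ be its Auslander–Reiten translation. For $X\in\mathrm{mod}(A)$, let $\mathrm{rk}(X)$ be the number of isomorphism classes of indecomposable direct summands of $X$, let $\mathrm{Fac}(X)$ be the class of all quotients of finite direct sums of copies of $X$, and let $X^\perp=\{Y\in\mathrm{mod}(A):\mathrm{Hom}_A(X,Y)=0\}$. Put $n=\mathrm{rk}({}_AA)$. A stratifying system of size $s$ in $\mathrm{mod}(A)$ is a family $\Theta=\{\Theta(i)\}_{i=1}^s$ of indecomposable modules in $\mathrm{mod}(A)$ together with a linear order $\le$ on $[1,s]=\{1,\dots,s\}$ such that $\mathrm{Hom}_A(\Theta(j),\Theta(i))=0$ whenever $j>i$, and $\mathrm{Ext}^1_A(\Theta(j),\Theta(i))=0$ whenever $j\ge i$. Let $M\in\mathrm{mod}(A)$ be a basic non-zero $\tau$-rigid module, i.e. $M\neq 0$ is a direct sum of pairwise non-isomorphic indecomposable modules and $\mathrm{Hom}_A(M,\tau M)=0$. Let $M=\bigoplus_{i=1}^t M_i$ be a TF-admissible decomposition,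 i.e. every $M_i$ is indecomposable and $M_i\notin\mathrm{Fac}\big(\bigoplus_{j>i}M_j\big)$ for every $i\in[1,t]$. Then for every $i\in[1,t]$ the pair $\big(\mathrm{Fac}(\bigoplus_{j>i}M_j),\,(\bigoplus_{j>i}M_j)^\perp\big)$ is a torsion pair in $\mathrm{mod}(A)$. Let $\Delta_M(i)=M_i/\mathrm{t}(M_i)$ be the torsion-free part of $M_i$ with respect to it, where $\mathrm{t}(M_i)$ is the largest submodule of $M_i$ lying in $\mathrm{Fac}(\bigoplus_{j>i}M_j)$. The following statements hold. (a) The family $\Delta_M=\{\Delta_M(i)\}_{i=1}^t$ with the natural order on $[1,t]$ is a stratifying system of size $t$ in $\mathrm{mod}(A)$. (b) We have $t\le n$, and there is a stratifying system $\Delta'_M$ of size $n$ in $\mathrm{mod}(A)$, with respect to the natural order on $[1,n]$, such that $\Delta'_M(n-t+i)=\Delta_M(i)$ for all $i\in[1,t]$. -/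

import Mathlib

open CategoryTheory CategoryTheory.Limits

universe u

namespace TauStrat

/-! ### Nakayama functor, Auslander-Reiten translate, τ-rigid modules -/

section Nakayama

variable (k A : Type u) [Field k] [Ring A] [Algebra k A]

/-- `ν P = D Hom_A(P, A)`, where `D = Hom_k(-, k)`. -/
def Nakayama (P : Type u) [AddCommGroup P] [Module A P] : Type u :=
  Module.Dual k (P →ₗ[A] A)

variable (P : Type u) [AddCommGroup P] [Module A P]

instance : AddCommGroup (Nakayama k A P) :=
  inferInstanceAs (AddCommGroup (Module.Dual k (P →ₗ[A] A)))

variable {k A P}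

/-- Evaluation of an element of `D Hom_A(P, A)` at a homomorphism. -/
def Nakayama.eval (φ : Nakayama k A P) : (P →ₗ[A] A) →ₗ[k] k := φ

theorem Nakayama.ext {φ ψ : Nakayama k A P} (h : ∀ f, φ.eval f = ψ.eval f) : φ = ψ :=
  LinearMap.ext h

@[simp] theorem Nakayama.eval_zero (f : P →ₗ[A] A) : (0 : Nakayama k A P).eval f = 0 := rfl

@[simp] theorem Nakayama.eval_add (φ ψ : Nakayama k A P) (f : P →ₗ[A] A) :
    (φ + ψ).eval f = φ.eval f + ψ.eval f := rfl

/-- The left `A`-action on `D Hom_A(P, A)`: `(a • φ) f = φ (f a)`, where `Hom_A(P, A)` is a right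
`A`-module through `(f a) p = (f p) * a`. -/
instance : SMul A (Nakayama k A P) where
  smul a φ := (φ.eval ∘ₗ DistribSMul.toLinearMap k (P →ₗ[A] A) (MulOpposite.op a) :
    Module.Dual k (P →ₗ[A] A))

@[simp] theorem Nakayama.eval_smul (a : A) (φ : Nakayama k A P) (f : P →ₗ[A] A) :
    (a • φ).eval f = φ.eval (MulOpposite.op a • f) := rfl

instance : Module A (Nakayama k A P) where
  one_smul φ := Nakayama.ext fun f => by simp
  mul_smul a b φ := Nakayama.ext fun f => by simp [mul_smul]
  smul_zero a := Nakayama.ext fun f => by simp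
  smul_add a φ ψ := Nakayama.ext fun f => by simp
  add_smul a b φ := Nakayama.ext fun f => by simp [add_smul]
  zero_smul φ := Nakayama.ext fun f => by simp

variable (k) {Q : Type u} [AddCommGroup Q] [Module A Q]

/-- The action of the Nakayama functor on maps: `(ν d φ) f = φ (f ∘ d)`. -/
def Nakayama.map (d : P →ₗ[A] Q) : Nakayama k A P →ₗ[A] Nakayama k A Q where
  toFun φ :=
    ({ toFun := fun f => φ.eval (f ∘ₗ d)
       map_add' := fun f g => by rw [LinearMap.add_comp, map_add]
       map_smul' := fun c f => by rw [LinearMap.smul_comp, map_smul, RingHom.id_apply] } :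
      Module.Dual k (Q →ₗ[A] A))
  map_add' _ _ := rfl
  map_smul' _ _ := rfl

end Nakayama

/-- A submodule `K` of `P` is superfluous if `L + K = P` forces `L = P`. -/
def IsSuperfluous {A P : Type u} [Ring A] [AddCommGroup P] [Module A P] (K : Submodule A P) :
    Prop :=
  ∀ L : Submodule A P, L ⊔ K = ⊤ → L = ⊤

/-- A minimal projective presentation `P₁ → P₀ → M → 0` by finitely generated projectives:
`π : P₀ → M` and `d : P₁ → ker π` are projective covers. -/
structure MinProjPresentation {A : Type u} [Ring A] (M : ModuleCat.{u} A) where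
  P₁ : ModuleCat.{u} A
  P₀ : ModuleCat.{u} A
  finite₁ : Module.Finite A P₁
  finite₀ : Module.Finite A P₀
  projective₁ : Module.Projective A P₁
  projective₀ : Module.Projective A P₀
  d : P₁ →ₗ[A] P₀
  π : P₀ →ₗ[A] M
  surjective_π : Function.Surjective π
  exact : LinearMap.range d = LinearMap.ker π
  superfluous_ker_π : IsSuperfluous (LinearMap.ker π)
  superfluous_ker_d : IsSuperfluous (LinearMap.ker d)

/-- The Auslander-Reiten translate `τ M = ker (ν d : ν P₁ → ν P₀)`, computed from a minimal
projective presentation of `M`. -/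
abbrev MinProjPresentation.tau (k : Type u) {A : Type u} [Field k] [Ring A] [Algebra k A]
    {M : ModuleCat.{u} A} (p : MinProjPresentation M) : Submodule A (Nakayama k A p.P₁) :=
  LinearMap.ker (Nakayama.map k p.d)

/-- `M` is τ-rigid if `Hom_A(M, τ M) = 0`. A minimal projective presentation of a finitely generated
module over a finite dimensional algebra exists and is unique up to isomorphism, so that it does not
matter which one is used to compute `τ M`. -/
def IsTauRigid (k : Type u) {A : Type u} [Field k] [Ring A] [Algebra k A] (M : ModuleCat.{u} A) :
    Prop :=
  ∃ p : MinProjPresentation M, ∀ f : M →ₗ[A] p.tau k, f = 0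

section Modules

variable {A : Type u} [Ring A]

/-! ### Rank and basic modules -/

/-- `rk M`: the number of isomorphism classes of indecomposable direct summands of `M`. -/
noncomputable def rk (M : ModuleCat.{u} A) : ℕ :=
  Set.ncard {c : Quotient (isIsomorphicSetoid (ModuleCat.{u} A)) |
    ∃ X : ModuleCat.{u} A, c = Quotient.mk _ X ∧ Indecomposable X ∧
      ∃ Y : ModuleCat.{u} A, Nonempty (M ≃ₗ[A] (X × Y))}

/-- `M` is basic if it is a finite direct sum of pairwise non-isomorphic indecomposable modules. -/
def IsBasic (M : ModuleCat.{u} A) : Prop :=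
  ∃ (s : ℕ) (X : Fin s → ModuleCat.{u} A), (∀ i, Indecomposable (X i)) ∧
    (∀ i j, i ≠ j → IsEmpty (X i ≅ X j)) ∧ Nonempty (M ≃ₗ[A] (∀ i, X i))

/-! ### Torsion pairs -/

/-- `Fac M`: the finitely generated quotients of finite powers of `M`. -/
def Fac (M : ModuleCat.{u} A) : ObjectProperty (ModuleCat.{u} A) := fun X =>
  Module.Finite A X ∧ ∃ (n : ℕ) (f : (Fin n → M) →ₗ[A] X), Function.Surjective f

/-- `M^⊥`: the finitely generated modules `X` with `Hom_A(M, X) = 0`. -/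
def rightPerp (M : ModuleCat.{u} A) : ObjectProperty (ModuleCat.{u} A) := fun X =>
  Module.Finite A X ∧ ∀ f : M →ₗ[A] X, f = 0

/-- `(T, F)` is a torsion pair in `mod A`, i.e. `T = ^⊥F` and `F = T^⊥` inside the category of
finitely generated modules. -/
structure IsTorsionPair (T F : ObjectProperty (ModuleCat.{u} A)) : Prop where
  torsion_iff : ∀ X : ModuleCat.{u} A,
    T X ↔ Module.Finite A X ∧ ∀ Y : ModuleCat.{u} A, F Y → ∀ f : X →ₗ[A] Y, f = 0
  torsionFree_iff : ∀ Y : ModuleCat.{u} A,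
    F Y ↔ Module.Finite A Y ∧ ∀ X : ModuleCat.{u} A, T X → ∀ f : X →ₗ[A] Y, f = 0

/-- The torsion part `t(X)` of `X` with respect to a torsion class `T`: the largest submodule of `X`
lying in `T`. -/
def torsionPart (T : ObjectProperty (ModuleCat.{u} A)) (X : ModuleCat.{u} A) : Submodule A X :=
  sSup {L : Submodule A X | T (ModuleCat.of A L)}

/-- The torsion free part `f(X) = X / t(X)`. -/
abbrev torsionFreePart (T : ObjectProperty (ModuleCat.{u} A)) (X : ModuleCat.{u} A) :
    ModuleCat.{u} A :=
  ModuleCat.of A (X ⧸ torsionPart T X)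

/-! ### TF-admissible decompositions and stratifying systems -/

/-- `⨁_{j > i} M_j` (a finite direct sum, hence the product). -/
abbrev tailSum {t : ℕ} (M : Fin t → ModuleCat.{u} A) (i : Fin t) : ModuleCat.{u} A :=
  ModuleCat.of A (∀ j : {j : Fin t // i < j}, M j)

/-- `M ≅ ⨁ M_i` is a TF-admissible decomposition: the `M_i` are indecomposable and
`M_i ∉ Fac (⨁_{j > i} M_j)` for every `i`. -/
structure IsTFAdmissible (M : ModuleCat.{u} A) {t : ℕ} (Mi : Fin t → ModuleCat.{u} A) : Prop where
  decomposition : Nonempty (M ≃ₗ[A] (∀ i, Mi i))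
  indecomposable : ∀ i, Indecomposable (Mi i)
  not_fac : ∀ i, ¬ Fac (tailSum Mi i) (Mi i)

/-- `Δ_M(i)`: the torsion free part of `M_i` with respect to the torsion pair
`(Fac (⨁_{j > i} M_j), (⨁_{j > i} M_j)^⊥)`. -/
abbrev Delta {t : ℕ} (M : Fin t → ModuleCat.{u} A) (i : Fin t) : ModuleCat.{u} A :=
  torsionFreePart (Fac (tailSum M i)) (M i)

/-- A stratifying system in `mod A`, indexed by a linearly ordered set (`Fin t` with its natural
order for a system of size `t`): `Hom(Θ(j), Θ(i)) = 0` for `j > i` and `Ext¹(Θ(j), Θ(i)) = 0` for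
`j ≥ i`. -/
structure IsStratifyingSystem {ι : Type} [LinearOrder ι] (Θ : ι → ModuleCat.{u} A) : Prop where
  finite : ∀ i, Module.Finite A (Θ i)
  indecomposable : ∀ i, Indecomposable (Θ i)
  hom_eq_zero : ∀ i j, i < j → ∀ f : Θ j →ₗ[A] Θ i, f = 0
  ext_eq_zero : ∀ i j, i ≤ j → Subsingleton (Abelian.Ext.{u} (Θ j) (Θ i) 1)

end Modules

end TauStrat

/-! Fix a minimal projective presentation `d : P₁ → P₀` of `M`, and let T be the class of finitely
generated modules `X` such that every map `P₁ → X` factors through `d` (`Extends d`). T is closed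
under quotients and finite products. One half of the Auslander-Reiten formula shows that τ-rigidity
puts `M` in T. Being the cokernel of `d`, `M` lifts along every surjection whose kernel lies in T
(`ExtProj d`). Both properties pass to summands and finite sums, and `Fac U` stays inside T when `U`
is in T. Statement (a) and the torsion pairs then come from lifting: maps into a torsion-free part,
idempotents of `Δ(i)`, and sections of extensions of `Δ(j)` by `Δ(i)` are all treated by first
lifting a map out of `M_j` or out of the tail sum.

For (b), each indecomposable projective `P i` has a universal extension `P i → E i → M^m → 0`
(Bongartz), with `E i` in T and relatively projective. The indecomposable summands of the `E i` that
are not among the `M_j`, one per isomorphism class, are put in front of the `M_j`, which leaves the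
old tails unchanged. The longer sequence is still TF-admissible
(`MinProjPresentation.exists_retract_of_fac`), so the argument for (a) applies to it. Its length is
found by linear algebra (`card_eq_of_mem_span`). For relatively projective `N` the function `X ↦ dim
Hom(N, X)` on T is additive on short exact sequences, and an additive function is determined by one
number per simple module. The terms of the sequence give independent functions, by triangularity at
the `Δ(i)`, and these span because `dim Hom(P i, -) = dim Hom(E i, -) - m dim Hom(M, -)` on T. -/

namespace TauStrat

/-! ### Indecomposable modules, local endomorphism rings and Krull-Schmidt. -/

section KrullSchmidt

variable {A : Type u} [Ring A]

/-- A module is indecomposable if it is nonzero and its only idempotent endomorphisms are `0`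
and `1`. -/
def IsIndec (A : Type u) [Ring A] (X : Type u) [AddCommGroup X] [Module A X] : Prop :=
  Nontrivial X ∧ ∀ e : Module.End A X, IsIdempotentElem e → e = 0 ∨ e = 1

theorem isIndec_of_indecomposable {X : ModuleCat.{u} A} (hX : Indecomposable X) :
    IsIndec A X := by
  refine ⟨?_, fun e he => ?_⟩
  · by_contra h
    rw [not_nontrivial_iff_subsingleton] at h
    exact hX.1 (ModuleCat.isZero_of_subsingleton X)
  · have φ : X ≅ ModuleCat.of A (LinearMap.range e) ⊞ ModuleCat.of A (LinearMap.ker e) :=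
      (Submodule.prodEquivOfIsCompl _ _ (LinearMap.IsIdempotentElem.isCompl he)).symm.toModuleIso ≪≫
        (ModuleCat.biprodIsoProd (ModuleCat.of A (LinearMap.range e))
          (ModuleCat.of A (LinearMap.ker e))).symm
    rcases hX.2 _ _ φ with h | h
    · have := (ModuleCat.isZero_iff_subsingleton).1 h
      left
      exact LinearMap.range_eq_bot.1 ((Submodule.subsingleton_iff_eq_bot).1 this)
    · have := (ModuleCat.isZero_iff_subsingleton).1 h
      right
      have hk : LinearMap.ker e = ⊥ := (Submodule.subsingleton_iff_eq_bot).1 this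
      ext x
      have := LinearMap.congr_fun he x
      exact LinearMap.ker_eq_bot.1 hk this

theorem indecomposable_of_isIndec {X : ModuleCat.{u} A} (hX : IsIndec A X) :
    Indecomposable X := by
  refine ⟨fun h => ?_, fun Y Z φ => ?_⟩
  · have := (ModuleCat.isZero_iff_subsingleton).1 h
    exact not_nontrivial_iff_subsingleton.2 this hX.1
  · let ψ : X ≃ₗ[A] Y × Z := (φ ≪≫ ModuleCat.biprodIsoProd Y Z).toLinearEquiv
    let e : Module.End A X :=
      ψ.symm.toLinearMap ∘ₗ LinearMap.inl A Y Z ∘ₗ LinearMap.fst A Y Z ∘ₗ ψ.toLinearMap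
    have he : IsIdempotentElem e := by
      ext x
      simp [e]
    rcases hX.2 e he with h | h
    · left
      rw [ModuleCat.isZero_iff_subsingleton]
      refine subsingleton_of_forall_eq 0 fun y => ?_
      have := LinearMap.congr_fun h (ψ.symm (y, 0))
      simpa [e] using this
    · right
      rw [ModuleCat.isZero_iff_subsingleton]
      refine subsingleton_of_forall_eq 0 fun y => ?_
      have := LinearMap.congr_fun h (ψ.symm (0, y))
      simpa [e, eq_comm] using this

section

variable {X Y : Type u} [AddCommGroup X] [Module A X] [AddCommGroup Y] [Module A Y]

/-- Fitting's lemma. -/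
theorem IsIndec.isLocalRing [IsNoetherian A X] [IsArtinian A X] (hX : IsIndec A X) :
    IsLocalRing (Module.End A X) := by
  have := hX.1
  refine IsLocalRing.of_isUnit_or_isUnit_one_sub_self fun f => ?_
  obtain ⟨n, hn⟩ := Filter.eventually_atTop.1 f.eventually_isCompl_ker_pow_range_pow
  -- The exponent `n + 1` is nonzero, which is needed to pass from a unit power of `f` to `f`
  -- itself.
  have hc := hn (n + 1) (by omega)
  let p := (LinearMap.ker (f ^ (n + 1))).projection _ hc
  have hp : IsIdempotentElem p := Submodule.isIdempotentElem_projection hc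
  have hpr : LinearMap.range p = LinearMap.ker (f ^ (n + 1)) := Submodule.range_projection hc
  have hpk : LinearMap.ker p = LinearMap.range (f ^ (n + 1)) := Submodule.ker_projection hc
  rcases hX.2 p hp with h | h
  · left
    rw [h, LinearMap.range_zero] at hpr
    rw [h, LinearMap.ker_zero] at hpk
    have : IsUnit (f ^ (n + 1)) := by
      rw [Module.End.isUnit_iff]
      exact ⟨LinearMap.ker_eq_bot.1 hpr.symm, LinearMap.range_eq_top.1 hpk.symm⟩
    exact (isUnit_pow_iff (by omega)).1 this
  · right
    refine IsNilpotent.isUnit_one_sub ⟨n + 1, ?_⟩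
    rw [h] at hpr
    exact LinearMap.ker_eq_top.1 (hpr.symm.trans (LinearMap.range_eq_top.2 fun x => ⟨x, rfl⟩))

theorem IsIndec.congr (φ : X ≃ₗ[A] Y) (hX : IsIndec A X) : IsIndec A Y := by
  refine ⟨by have := hX.1; exact φ.symm.toEquiv.nontrivial, fun e he => ?_⟩
  rcases hX.2 (φ.symm.toLinearMap ∘ₗ e ∘ₗ φ.toLinearMap) (by
    ext x
    simpa using LinearMap.congr_fun he (φ x)) with h | h
  · left
    ext y
    simpa using LinearMap.congr_fun h (φ.symm y)
  · right
    ext y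
    simpa [LinearEquiv.symm_apply_eq] using LinearMap.congr_fun h (φ.symm y)

/-- A nonzero retract of an indecomposable module is isomorphic to it. -/
theorem IsIndec.bijective_of_retract [Nontrivial X] (hY : IsIndec A Y) (s : X →ₗ[A] Y)
    (r : Y →ₗ[A] X) (h : r ∘ₗ s = LinearMap.id) : Function.Bijective s := by
  have hrs : ∀ x, r (s x) = x := fun x => LinearMap.congr_fun h x
  rcases hY.2 (s ∘ₗ r) (by ext y; simp [hrs]) with h0 | h1
  · obtain ⟨x, hx⟩ := exists_ne (0 : X)
    have := LinearMap.congr_fun h0 (s x)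
    simp only [LinearMap.comp_apply, hrs, LinearMap.zero_apply] at this
    exact absurd (by rw [← hrs x, this, map_zero]) hx
  · exact ⟨Function.LeftInverse.injective hrs,
      Function.RightInverse.surjective fun y => LinearMap.congr_fun h1 y⟩

/-- A module with local endomorphism ring which is a retract of a finite product of modules
is a retract of one of the factors. -/
theorem exists_retract_of_retract_pi {ι : Type*} [Fintype ι] {U : ι → Type u}
    [∀ i, AddCommGroup (U i)] [∀ i, Module A (U i)] [IsLocalRing (Module.End A X)]
    (s : X →ₗ[A] ∀ i, U i) (r : (∀ i, U i) →ₗ[A] X) (h : r ∘ₗ s = LinearMap.id) :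
    ∃ (i : ι) (s' : X →ₗ[A] U i) (r' : U i →ₗ[A] X), r' ∘ₗ s' = LinearMap.id := by
  classical
  -- The identity is the sum of the endomorphisms through the single factors; in a local ring one of
  -- them is a unit.
  have hsum : ∑ i, (r ∘ₗ LinearMap.single A U i ∘ₗ LinearMap.proj i ∘ₗ s : Module.End A X) =
      1 := by
    ext x
    have : r (s x) = x := LinearMap.congr_fun h x
    simp only [LinearMap.sum_apply, LinearMap.comp_apply, LinearMap.proj_apply,
      Module.End.one_apply, ← map_sum]
    conv_rhs => rw [← this]
    congr 1
    exact LinearMap.sum_single_apply U (s x)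
  obtain ⟨i, -, hi⟩ := IsLocalRing.exists_of_isUnit_sum (hsum ▸ isUnit_one)
  obtain ⟨w, hw⟩ := hi.exists_left_inv
  exact ⟨i, LinearMap.proj i ∘ₗ s, w ∘ₗ r ∘ₗ LinearMap.single A U i, hw⟩

theorem IsIndec.exists_equiv_of_retract_pi [IsNoetherian A X] [IsArtinian A X] {ι : Type*}
    [Fintype ι] {U : ι → Type u}
    [∀ i, AddCommGroup (U i)] [∀ i, Module A (U i)] (hX : IsIndec A X)
    (hU : ∀ i, IsIndec A (U i))
    (s : X →ₗ[A] ∀ i, U i) (r : (∀ i, U i) →ₗ[A] X) (h : r ∘ₗ s = LinearMap.id) :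
    ∃ i, Nonempty (X ≃ₗ[A] U i) := by
  have := hX.isLocalRing
  have := hX.1
  obtain ⟨i, s', r', h'⟩ := exists_retract_of_retract_pi s r h
  exact ⟨i, ⟨LinearEquiv.ofBijective s' ((hU i).bijective_of_retract s' r' h')⟩⟩

end

/-- Every module of finite length is a finite product of indecomposable modules. -/
theorem exists_indecomposable_decomposition (X : ModuleCat.{u} A) [IsNoetherian A X]
    [IsArtinian A X] : ∃ (ι : Type) (_ : Fintype ι) (Y : ι → ModuleCat.{u} A),
      (∀ i, IsIndec A (Y i)) ∧ Nonempty (X ≃ₗ[A] ∀ i, Y i) := by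
  suffices H : ∀ L : Submodule A X, ∃ (ι : Type) (_ : Fintype ι) (Y : ι → ModuleCat.{u} A),
      (∀ i, IsIndec A (Y i)) ∧ Nonempty (L ≃ₗ[A] ∀ i, Y i) by
    obtain ⟨ι, hι, Y, h, ⟨φ⟩⟩ := H ⊤
    exact ⟨ι, hι, Y, h, ⟨Submodule.topEquiv.symm.trans φ⟩⟩
  intro L
  induction L using WellFoundedLT.induction with
  | ind L ih =>
  by_cases hn : Nontrivial L
  swap
  · rw [not_nontrivial_iff_subsingleton] at hn
    exact ⟨Empty, inferInstance, fun e => e.elim, fun e => e.elim, ⟨0⟩⟩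
  by_cases hL : IsIndec A L
  · exact ⟨Unit, inferInstance, fun _ => ModuleCat.of A L, fun _ => hL,
      ⟨(LinearEquiv.funUnique Unit A L).symm⟩⟩
  · simp only [IsIndec, hn, true_and, not_forall, not_or] at hL
    obtain ⟨e, he, h0, h1⟩ := hL
    have hc := LinearMap.IsIdempotentElem.isCompl he
    have key : ∀ K : Submodule A L, K ≠ ⊤ →
        ∃ (ι : Type) (_ : Fintype ι) (Y : ι → ModuleCat.{u} A),
      (∀ i, IsIndec A (Y i)) ∧ Nonempty (K ≃ₗ[A] ∀ i, Y i) := by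
      intro K hK
      obtain ⟨ι, hι, Y, hY, ⟨φ⟩⟩ := ih (K.map L.subtype) (by
        refine lt_of_le_of_ne (Submodule.map_subtype_le _ _) fun h => hK ?_
        apply Submodule.map_injective_of_injective L.injective_subtype
        rw [h, Submodule.map_top, Submodule.range_subtype])
      exact ⟨ι, hι, Y, hY, ⟨(Submodule.equivMapOfInjective _ L.injective_subtype K).trans φ⟩⟩
    obtain ⟨ι₁, _, Y₁, hY₁, ⟨φ₁⟩⟩ := key (LinearMap.range e) (fun h => h1 (by
      ext x
      obtain ⟨y, rfl⟩ := LinearMap.range_eq_top.1 h x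
      rw [← Module.End.mul_apply, he]; rfl))
    obtain ⟨ι₂, _, Y₂, hY₂, ⟨φ₂⟩⟩ := key (LinearMap.ker e) (fun h => h0 (LinearMap.ker_eq_top.1 h))
    refine ⟨ι₁ ⊕ ι₂, inferInstance, Sum.elim Y₁ Y₂, ?_, ⟨?_⟩⟩
    · rintro (i | i)
      exacts [hY₁ i, hY₂ i]
    · exact (Submodule.prodEquivOfIsCompl _ _ hc).symm.trans ((φ₁.prodCongr φ₂).trans
        (LinearEquiv.sumPiEquivProdPi A ι₁ ι₂ fun i => (Sum.elim Y₁ Y₂ i : ModuleCat A)).symm)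

/-- A finite family of objects has a subfamily of representatives of the isomorphism classes. -/
theorem exists_representatives {C : Type*} [Category C] {ι : Type} [Finite ι] (X : ι → C) :
    ∃ (r : ℕ) (σ : Fin r → ι), (∀ i j, i ≠ j → IsEmpty (X (σ i) ≅ X (σ j))) ∧
      (∀ j, ∃ i, Nonempty (X j ≅ X (σ i))) ∧
      r = (Set.range fun j => (Quotient.mk (isIsomorphicSetoid C) (X j))).ncard := by
  let S := Set.range fun j => (Quotient.mk (isIsomorphicSetoid C) (X j))
  have : Finite S := Set.finite_range _
  let e : S ≃ Fin S.ncard := Finite.equivFinOfCardEq rfl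
  choose σ hσ using fun i : Fin S.ncard => (e.symm i).2
  refine ⟨S.ncard, σ, fun i j hij => ⟨fun φ => hij ?_⟩, fun j => ⟨e ⟨_, j, rfl⟩, ?_⟩, rfl⟩
  · apply e.symm.injective
    apply Subtype.ext
    rw [← hσ, ← hσ]
    exact Quotient.sound ⟨φ⟩
  · have := hσ (e ⟨_, j, rfl⟩)
    rw [Equiv.symm_apply_apply] at this
    exact Quotient.exact this.symm

end KrullSchmidt

/-! ### The torsion class of `d` and its relatively projective modules. -/

section ExtProjective

variable {A : Type u} [Ring A]

/-- `Hom(d, X)` is surjective for `d : P₁ → P₀`: every map `P₁ → X` factors through `d`. -/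
def Extends {P₁ P₀ : Type u} [AddCommGroup P₁] [Module A P₁] [AddCommGroup P₀] [Module A P₀]
    (d : P₁ →ₗ[A] P₀) (X : Type u) [AddCommGroup X] [Module A X] : Prop :=
  ∀ g : P₁ →ₗ[A] X, ∃ h : P₀ →ₗ[A] X, h ∘ₗ d = g

/-- `N` has the lifting property with respect to the surjections whose kernel `K` satisfies
`Extends d K`. -/
def ExtProj {P₁ P₀ : Type u} [AddCommGroup P₁] [Module A P₁] [AddCommGroup P₀] [Module A P₀]
    (d : P₁ →ₗ[A] P₀) (N : Type u) [AddCommGroup N] [Module A N] : Prop :=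
  ∀ ⦃X Y : Type u⦄ [AddCommGroup X] [Module A X] [AddCommGroup Y] [Module A Y] (q : X →ₗ[A] Y),
    Function.Surjective q → Extends d (LinearMap.ker q) →
      ∀ g : N →ₗ[A] Y, ∃ g' : N →ₗ[A] X, q ∘ₗ g' = g

variable {P₁ P₀ : Type u} [AddCommGroup P₁] [Module A P₁] [AddCommGroup P₀] [Module A P₀]
  {d : P₁ →ₗ[A] P₀}
variable {X Y N : Type u} [AddCommGroup X] [Module A X] [AddCommGroup Y] [Module A Y]
  [AddCommGroup N] [Module A N]

theorem Extends.of_surjective [Module.Projective A P₁] (hX : Extends d X) (q : X →ₗ[A] Y)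
    (hq : Function.Surjective q) : Extends d Y := fun g => by
  obtain ⟨g', hg'⟩ := Module.projective_lifting_property q g hq
  obtain ⟨h, hh⟩ := hX g'
  exact ⟨q ∘ₗ h, by rw [LinearMap.comp_assoc, hh, hg']⟩

theorem Extends.congr (hX : Extends d X) (φ : X ≃ₗ[A] Y) : Extends d Y := fun g => by
  obtain ⟨h, hh⟩ := hX (φ.symm.toLinearMap ∘ₗ g)
  exact ⟨φ.toLinearMap ∘ₗ h, by rw [LinearMap.comp_assoc, hh]; ext; simp⟩

theorem Extends.pi {ι : Type*} {U : ι → Type u} [∀ i, AddCommGroup (U i)] [∀ i, Module A (U i)]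
    (hU : ∀ i, Extends d (U i)) (φ : (∀ i, U i) ≃ₗ[A] Y) :
    Extends d Y := fun g => by
  choose h hh using fun i => hU i (LinearMap.proj i ∘ₗ φ.symm.toLinearMap ∘ₗ g)
  refine ⟨φ.toLinearMap ∘ₗ LinearMap.pi h, LinearMap.ext fun x => ?_⟩
  simp only [LinearMap.comp_apply, LinearEquiv.coe_coe]
  rw [← LinearEquiv.eq_symm_apply]
  ext i
  exact LinearMap.congr_fun (hh i) x

theorem Extends.prod (hX : Extends d X) (hY : Extends d Y) : Extends d (X × Y) := fun g => by
  obtain ⟨h₁, hh₁⟩ := hX (LinearMap.fst A X Y ∘ₗ g)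
  obtain ⟨h₂, hh₂⟩ := hY (LinearMap.snd A X Y ∘ₗ g)
  exact ⟨h₁.prod h₂, LinearMap.ext fun x =>
    Prod.ext (LinearMap.congr_fun hh₁ x) (LinearMap.congr_fun hh₂ x)⟩

theorem ExtProj.of_retract (hN : ExtProj d N) (s : X →ₗ[A] N) (r : N →ₗ[A] X)
    (h : r ∘ₗ s = LinearMap.id) : ExtProj d X := fun Z W _ _ _ _ q hq hk g => by
  obtain ⟨g', hg'⟩ := hN q hq hk (g ∘ₗ r)
  exact ⟨g' ∘ₗ s, by rw [← LinearMap.comp_assoc, hg', LinearMap.comp_assoc, h, LinearMap.comp_id]⟩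

theorem ExtProj.pi {ι : Type} [Finite ι] {U : ι → Type u} [∀ i, AddCommGroup (U i)]
    [∀ i, Module A (U i)] (hU : ∀ i, ExtProj d (U i)) (φ : N →ₗ[A] ∀ i, U i)
    (ψ : (∀ i, U i) →ₗ[A] N) (hφ : ψ ∘ₗ φ = LinearMap.id) : ExtProj d N := by
  classical
  have := Fintype.ofFinite ι
  refine ExtProj.of_retract (N := ∀ i, U i) ?_ φ ψ hφ
  intro Z W _ _ _ _ q hq hk g
  choose h hh using fun i => hU i q hq hk (g ∘ₗ LinearMap.single A U i)
  refine ⟨LinearMap.lsum A U ℕ h, LinearMap.pi_ext' fun i => ?_⟩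
  rw [← hh i]
  ext x
  simp only [LinearMap.comp_apply, LinearMap.lsum_apply, LinearMap.sum_apply,
    LinearMap.proj_apply, LinearMap.single_apply]
  rw [Finset.sum_eq_single i (fun j _ hj => by rw [Pi.single_eq_of_ne hj, map_zero])
    (fun hi => absurd (Finset.mem_univ i) hi), Pi.single_eq_same]

/-- Lift `g ∘ π` to `u : Q₀ → X`. On `Q₁` it lands in `ker q`, where it extends along `δ` to a map
on `Q₀`; subtracting this extension makes `u` vanish on `ker π`, so it descends to `N`. -/
theorem ExtProj.of_presentation {Q₁ Q₀ : Type u} [AddCommGroup Q₁] [Module A Q₁]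
    [AddCommGroup Q₀] [Module A Q₀] [Module.Projective A Q₀] (δ : Q₁ →ₗ[A] Q₀) (π : Q₀ →ₗ[A] N)
    (hπ : Function.Surjective π) (hδ : LinearMap.range δ = LinearMap.ker π)
    (h : ∀ (X : Type u) [AddCommGroup X] [Module A X], Extends d X → Extends δ X) :
    ExtProj d N := fun X Y _ _ _ _ q hq hk g => by
  obtain ⟨u, hu⟩ := Module.projective_lifting_property q (g ∘ₗ π) hq
  have hqu : ∀ x, q (u x) = g (π x) := fun x => LinearMap.congr_fun hu x
  have hπδ : ∀ x, π (δ x) = 0 := fun x => LinearMap.mem_ker.1 (hδ ▸ LinearMap.mem_range_self δ x)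
  obtain ⟨e, he⟩ := h _ hk ((u ∘ₗ δ).codRestrict (LinearMap.ker q) fun x => by
    simp [hqu, hπδ])
  let v : Q₀ →ₗ[A] X := u - (LinearMap.ker q).subtype ∘ₗ e
  have hv : LinearMap.ker π ≤ LinearMap.ker v := by
    rw [← hδ]
    rintro _ ⟨x, rfl⟩
    have := congrArg Subtype.val (LinearMap.congr_fun he x)
    simp only [LinearMap.comp_apply, LinearMap.codRestrict_apply] at this
    simp [v, this]
  let φ := π.quotKerEquivOfSurjective hπ
  refine ⟨(LinearMap.ker π).liftQ v hv ∘ₗ φ.symm.toLinearMap, LinearMap.ext fun n => ?_⟩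
  obtain ⟨x, rfl⟩ := hπ n
  have : φ.symm (π x) = (LinearMap.ker π).mkQ x := by
    rw [LinearEquiv.symm_apply_eq]; rfl
  simp [this, v, hqu]

end ExtProjective

/-! ### Vanishing of Ext¹ from the splitting of extensions. -/

section Ext

variable {A : Type u} [Ring A]

/-- If every extension of `X` by `Y` splits then maps to `Y` extend along the kernel of any
surjection onto `X`. -/
theorem exists_extension_of_split {X Y P : Type u} [AddCommGroup X] [Module A X]
    [AddCommGroup Y] [Module A Y] [AddCommGroup P] [Module A P]
    (h : ∀ (Z : Type u) [AddCommGroup Z] [Module A Z] (q : Z →ₗ[A] X), Function.Surjective q →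
      ∀ _ : Y ≃ₗ[A] LinearMap.ker q, ∃ s : X →ₗ[A] Z, q ∘ₗ s = LinearMap.id)
    (q : P →ₗ[A] X) (hq : Function.Surjective q) (φ : LinearMap.ker q →ₗ[A] Y) :
    ∃ ψ : P →ₗ[A] Y, ψ ∘ₗ (LinearMap.ker q).subtype = φ := by
  -- `(P × Y) ⧸ R` is the pushout of `P` and `Y` along `ker q`, an extension of `X` by `Y`.
  let R : Submodule A (P × Y) := LinearMap.range ((LinearMap.ker q).subtype.prod (-φ))
  have hR : R ≤ LinearMap.ker (q ∘ₗ LinearMap.fst A P Y) := by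
    rintro _ ⟨x, rfl⟩
    simp
  let q' : ((P × Y) ⧸ R) →ₗ[A] X := R.liftQ _ hR
  have hq' : Function.Surjective q' := fun x => by
    obtain ⟨p, rfl⟩ := hq x
    exact ⟨R.mkQ (p, 0), by simp [q']⟩
  let j : Y →ₗ[A] LinearMap.ker q' :=
    (R.mkQ ∘ₗ LinearMap.inr A P Y).codRestrict _ fun y => by simp [q']
  have hj : Function.Bijective j := by
    refine ⟨(injective_iff_map_eq_zero j).2 fun y hy => ?_, ?_⟩
    · have : R.mkQ (0, y) = 0 := congrArg Subtype.val hy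
      rw [Submodule.mkQ_apply, Submodule.Quotient.mk_eq_zero] at this
      obtain ⟨x, hx⟩ := this
      have h1 : (x : P) = 0 := congrArg Prod.fst hx
      have h2 : -φ x = y := congrArg Prod.snd hx
      have h3 : x = 0 := Subtype.ext h1
      rw [← h2, h3, map_zero, neg_zero]
    · rintro ⟨z, hz⟩
      obtain ⟨⟨p, y⟩, rfl⟩ := R.mkQ_surjective z
      have hp : q p = 0 := by simpa [q'] using hz
      refine ⟨y + φ ⟨p, hp⟩, Subtype.ext ?_⟩
      change R.mkQ (0, y + φ ⟨p, hp⟩) = R.mkQ (p, y)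
      rw [← sub_eq_zero, ← map_sub, Submodule.mkQ_apply, Submodule.Quotient.mk_eq_zero]
      exact ⟨-⟨p, hp⟩, by simp⟩
  obtain ⟨s, hs⟩ := h _ q' hq' (LinearEquiv.ofBijective j hj)
  have hs' : ∀ x, q' (s x) = x := fun x => LinearMap.congr_fun hs x
  -- The canonical map `P → (P × Y) ⧸ R` and `s ∘ q` agree after `q'`, so their difference lands in
  -- the copy of `Y`; on `ker q` it is `φ`.
  let w : P →ₗ[A] LinearMap.ker q' :=
    (R.mkQ ∘ₗ LinearMap.inl A P Y - s ∘ₗ q).codRestrict _ fun p => by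
      simp [hs']
      simp [q']
  refine ⟨(LinearEquiv.ofBijective j hj).symm.toLinearMap ∘ₗ w, LinearMap.ext fun k => ?_⟩
  simp only [LinearMap.comp_apply, LinearEquiv.coe_coe]
  rw [LinearEquiv.symm_apply_eq]
  apply Subtype.ext
  have hk : q k = 0 := k.2
  change R.mkQ ((k : P), (0 : Y)) - s (q k) = R.mkQ (0, φ k)
  rw [hk, map_zero, sub_zero, ← sub_eq_zero, ← map_sub, Submodule.mkQ_apply,
    Submodule.Quotient.mk_eq_zero]
  exact ⟨k, by simp⟩

/-- Dimension shifting: along a projective cover-free presentation `0 → ker q → P → X → 0` every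
class is the connecting image of some `φ : ker q → Y`, and the image vanishes once `φ` extends to
`P`. -/
theorem subsingleton_ext_of_split (X Y : ModuleCat.{u} A)
    (h : ∀ (Z : Type u) [AddCommGroup Z] [Module A Z] (q : Z →ₗ[A] X), Function.Surjective q →
      ∀ _ : Y ≃ₗ[A] LinearMap.ker q, ∃ s : X →ₗ[A] Z, q ∘ₗ s = LinearMap.id) :
    Subsingleton (Abelian.Ext.{u} X Y 1) := by
  refine subsingleton_of_forall_eq 0 fun x => ?_
  obtain ⟨P, hP, q, hq⟩ : ∃ (P : ModuleCat.{u} A) (_ : Projective P) (q : P →ₗ[A] X),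
      Function.Surjective q :=
    ⟨ModuleCat.of A (X →₀ A), ModuleCat.projective_of_free Finsupp.basisSingleOne,
      Finsupp.linearCombination A id, Finsupp.linearCombination_id_surjective A X⟩
  let S : ShortComplex (ModuleCat.{u} A) :=
    ShortComplex.mk (ModuleCat.ofHom (LinearMap.ker q).subtype) (ModuleCat.ofHom q) (by
      ext y; exact y.2)
  have hS : S.ShortExact :=
    { exact := by
        rw [ShortComplex.moduleCat_exact_iff]
        intro p hp
        exact ⟨⟨p, hp⟩, rfl⟩
      mono_f := (ModuleCat.mono_iff_injective _).2 (Submodule.injective_subtype _)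
      epi_g := (ModuleCat.epi_iff_surjective _).2 hq }
  have : Projective S.X₂ := hP
  obtain ⟨x₁, rfl⟩ := Abelian.Ext.contravariant_sequence_exact₃ hS Y x
    (Abelian.Ext.eq_zero_of_projective _) (n₀ := 0) rfl
  obtain ⟨φ, rfl⟩ := (Abelian.Ext.mk₀_bijective _ _).2 x₁
  obtain ⟨ψ, hψ⟩ := exists_extension_of_split h q hq φ.hom
  have : φ = S.f ≫ ModuleCat.ofHom ψ := by
    ext x
    exact (LinearMap.congr_fun hψ x).symm
  rw [this, ← Abelian.Ext.mk₀_comp_mk₀, ← Abelian.Ext.comp_assoc_of_second_deg_zero,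
    hS.extClass_comp, Abelian.Ext.zero_comp]

end Ext

/-! ### Torsion pairs generated by relatively projective modules. -/

section Torsion

variable {A : Type u} [Ring A]

theorem Fac.of_pi_surjective {U X : ModuleCat.{u} A} {ι : Type} [Finite ι] [Module.Finite A X]
    (f : (ι → U) →ₗ[A] X) (hf : Function.Surjective f) : Fac U X := by
  obtain ⟨n, ⟨e⟩⟩ := Finite.exists_equiv_fin ι
  exact ⟨inferInstance, n, f ∘ₗ (LinearEquiv.funCongrLeft A U e).toLinearMap,
    hf.comp (LinearEquiv.surjective _)⟩

theorem Fac.hom_eq_zero {U X : ModuleCat.{u} A} (hX : Fac U X) {Y : Type u} [AddCommGroup Y]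
    [Module A Y] (hY : ∀ f : U →ₗ[A] Y, f = 0) (f : X →ₗ[A] Y) : f = 0 := by
  obtain ⟨-, n, g, hg⟩ := hX
  have : f ∘ₗ g = 0 := LinearMap.pi_ext' fun i => hY _
  ext x
  obtain ⟨y, rfl⟩ := hg x
  exact LinearMap.congr_fun this y

theorem Fac.extends {P₁ P₀ : Type u} [AddCommGroup P₁] [Module A P₁] [AddCommGroup P₀]
    [Module A P₀] {d : P₁ →ₗ[A] P₀} [Module.Projective A P₁] {U X : ModuleCat.{u} A}
    (hX : Fac U X) (hU : Extends d U) : Extends d X := by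
  obtain ⟨-, n, g, hg⟩ := hX
  exact (Extends.pi (fun _ : Fin n => hU) (LinearEquiv.refl A _)).of_surjective g hg

variable [IsNoetherianRing A]

theorem fac_of_range {U X : ModuleCat.{u} A} [Module.Finite A X] {ι : Type} [Finite ι]
    (f : (ι → U) →ₗ[A] X) : Fac U (ModuleCat.of A (LinearMap.range f)) :=
  Fac.of_pi_surjective (X := ModuleCat.of A (LinearMap.range f)) f.rangeRestrict
    f.surjective_rangeRestrict

/-- The submodules of `X` in `Fac U` are closed under sums and include zero, so by the noetherian
condition their supremum is one of them. -/
theorem fac_torsionPart (U X : ModuleCat.{u} A) [Module.Finite A X] :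
    Fac U (ModuleCat.of A (torsionPart (Fac U) X)) := by
  refine CompleteLattice.WellFoundedGT.isSupClosedCompact (Submodule A X) inferInstance
    {L : Submodule A X | Fac U (ModuleCat.of A L)} ⟨LinearMap.range (0 : (Fin 0 → U) →ₗ[A] X),
      fac_of_range _⟩ ?_
  rintro L ⟨-, n, f, hf⟩ L' ⟨-, n', f', hf'⟩
  let g : (Fin n ⊕ Fin n' → U) →ₗ[A] X :=
    ((L.subtype ∘ₗ f).coprod (L'.subtype ∘ₗ f')) ∘ₗ
      (LinearEquiv.sumPiEquivProdPi A (Fin n) (Fin n') fun _ => U).toLinearMap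
  have hg : LinearMap.range g = L ⊔ L' := by
    rw [LinearMap.range_comp_of_range_eq_top _ (LinearEquiv.range _), LinearMap.range_coprod,
      LinearMap.range_comp_of_range_eq_top _ (LinearMap.range_eq_top.2 hf),
      LinearMap.range_comp_of_range_eq_top _ (LinearMap.range_eq_top.2 hf'),
      Submodule.range_subtype, Submodule.range_subtype]
  rw [Set.mem_ofPred_eq, ← hg]
  exact fac_of_range g

theorem range_le_torsionPart (U X : ModuleCat.{u} A) [Module.Finite A X] (f : U →ₗ[A] X) :
    LinearMap.range f ≤ torsionPart (Fac U) X := by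
  refine le_sSup ?_
  have : LinearMap.range f = LinearMap.range (f ∘ₗ (LinearEquiv.funUnique Unit A U).toLinearMap) :=
    by rw [LinearMap.range_comp_of_range_eq_top _ (LinearEquiv.range _)]
  rw [Set.mem_ofPred_eq, this]
  exact fac_of_range _

variable {P₁ P₀ : Type u} [AddCommGroup P₁] [Module A P₁] [AddCommGroup P₀] [Module A P₀]
  {d : P₁ →ₗ[A] P₀} [Module.Projective A P₁]

/-- The torsion part lies in `Fac U`, hence in T, so `f` lifts to `U → X`; the image of the lift
lies in the torsion part and dies in the quotient. -/
theorem hom_torsionFreePart_eq_zero {U X : ModuleCat.{u} A} [Module.Finite A X]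
    (hU : Extends d U) (hU' : ExtProj d U) (f : U →ₗ[A] torsionFreePart (Fac U) X) : f = 0 := by
  obtain ⟨g, rfl⟩ := hU' (torsionPart (Fac U) X).mkQ (Submodule.mkQ_surjective _) (by
    rw [Submodule.ker_mkQ]
    exact (fac_torsionPart U X).extends hU) f
  ext x
  simpa using range_le_torsionPart U X g ⟨x, rfl⟩

theorem isTorsionPair_fac {U : ModuleCat.{u} A} [Module.Finite A U]
    (hU : Extends d U) (hU' : ExtProj d U) : IsTorsionPair (Fac U) (rightPerp U) := by
  refine ⟨fun X => ⟨fun hX => ⟨hX.1, fun Y hY f => hX.hom_eq_zero hY.2 f⟩, ?_⟩,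
    fun Y => ⟨fun hY => ⟨hY.1, fun X hX f => hX.hom_eq_zero hY.2 f⟩, fun h => ⟨h.1, fun f =>
      h.2 U (Fac.of_pi_surjective (ι := Unit) (LinearEquiv.funUnique Unit A U).toLinearMap
        (LinearEquiv.surjective _)) f⟩⟩⟩
  rintro ⟨hX, h⟩
  -- The torsion-free part lies in `U^⊥`, so the projection onto it vanishes and `X` equals its
  -- torsion part.
  have h0 := h (torsionFreePart (Fac U) X) ⟨inferInstance,
    fun f => hom_torsionFreePart_eq_zero hU hU' f⟩ (torsionPart (Fac U) X).mkQ
  have ht : torsionPart (Fac U) X = ⊤ := by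
    rw [← Submodule.ker_mkQ (torsionPart (Fac U) X), h0, LinearMap.ker_zero]
  have hF := fac_torsionPart U X
  obtain ⟨-, n, g, hg⟩ := hF
  refine ⟨hX, n, (torsionPart (Fac U) X).subtype ∘ₗ g, fun x => ?_⟩
  obtain ⟨y, hy⟩ := hg ⟨x, ht ▸ Submodule.mem_top⟩
  exact ⟨y, by simp [hy]⟩

end Torsion

/-! ### The torsion-free parts form a stratifying system. -/

section Stratifying

variable {A : Type u} [Ring A]
  {P₁ P₀ : Type u} [AddCommGroup P₁] [Module A P₁] [AddCommGroup P₀] [Module A P₀]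
  {d : P₁ →ₗ[A] P₀} {t : ℕ} {M : Fin t → ModuleCat.{u} A}

theorem extends_tailSum (hM : ∀ i, Extends d (M i)) (i : Fin t) : Extends d (tailSum M i) :=
  Extends.pi (U := fun j : {j : Fin t // i < j} => M j) (fun j => hM j) (LinearEquiv.refl A _)

theorem extProj_tailSum (hM' : ∀ i, ExtProj d (M i)) (i : Fin t) : ExtProj d (tailSum M i) :=
  ExtProj.pi (U := fun j : {j : Fin t // i < j} => M j) (fun j => hM' j) LinearMap.id
    LinearMap.id rfl

theorem Fac.hom_eq_zero_of_tailSum {i : Fin t} {X : ModuleCat.{u} A} (hX : Fac (tailSum M i) X)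
    {Y : Type u} [AddCommGroup Y] [Module A Y] (hY : ∀ j, i < j → ∀ f : M j →ₗ[A] Y, f = 0)
    (f : X →ₗ[A] Y) : f = 0 := by
  classical
  exact hX.hom_eq_zero (fun g => LinearMap.pi_ext' fun j => hY j j.2 _) f

variable [Module.Projective A P₁]

theorem extends_delta (hM : ∀ i, Extends d (M i)) (i : Fin t) : Extends d (Delta M i) :=
  (hM i).of_surjective _ (Submodule.mkQ_surjective (torsionPart (Fac (tailSum M i)) (M i)))

variable [IsNoetherianRing A] [∀ i, Module.Finite A (M i)]

theorem hom_delta_eq_zero (hM : ∀ i, Extends d (M i)) (hM' : ∀ i, ExtProj d (M i)) {i j : Fin t}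
    (hij : i < j) (f : M j →ₗ[A] Delta M i) : f = 0 := by
  classical
  have h := hom_torsionFreePart_eq_zero (extends_tailSum hM i) (extProj_tailSum hM' i)
    (f ∘ₗ LinearMap.proj (φ := fun j : {j : Fin t // i < j} => M j) ⟨j, hij⟩)
  ext x
  simpa using LinearMap.congr_fun h (Pi.single ⟨j, hij⟩ x)

theorem nontrivial_delta (hM : ∀ i, ¬ Fac (tailSum M i) (M i)) (i : Fin t) :
    Nontrivial (Delta M i) := by
  rw [Submodule.Quotient.nontrivial_iff]
  intro h
  obtain ⟨-, n, g, hg⟩ := fac_torsionPart (tailSum M i) (M i)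
  refine hM i ⟨inferInstance, n, (torsionPart (Fac (tailSum M i)) (M i)).subtype ∘ₗ g, fun x => ?_⟩
  obtain ⟨y, hy⟩ := hg ⟨x, h ▸ Submodule.mem_top⟩
  exact ⟨y, by simp [hy]⟩

variable [IsArtinianRing A]

/-- An idempotent `e` of `Δ(i)` lifts to an endomorphism `e'` of `M i`, not necessarily idempotent.
By locality `e'` or `1 - e'` is a unit, so `e` or `1 - e` is surjective, and a surjective idempotent
is the identity. -/
theorem isIndec_delta (hM : ∀ i, Extends d (M i)) (hM' : ∀ i, ExtProj d (M i))
    (hi : ∀ i, IsIndec A (M i)) (hF : ∀ i, ¬ Fac (tailSum M i) (M i)) (i : Fin t) :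
    IsIndec A (Delta M i) := by
  refine ⟨nontrivial_delta hF i, fun e he => ?_⟩
  have := (hi i).isLocalRing
  let q : M i →ₗ[A] Delta M i := (torsionPart (Fac (tailSum M i)) (M i)).mkQ
  have hq : Function.Surjective q := Submodule.mkQ_surjective _
  have hk : Extends d (LinearMap.ker q) := by
    rw [Submodule.ker_mkQ]
    exact (fac_torsionPart _ (M i)).extends (extends_tailSum hM i)
  obtain ⟨e', he'⟩ := hM' i q hq hk (e ∘ₗ q)
  have he2 : ∀ x, q (e' x) = e (q x) := fun x => LinearMap.congr_fun he' x
  have hee : ∀ x, e (e x) = e x := fun x => LinearMap.congr_fun he x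
  rcases IsLocalRing.isUnit_or_isUnit_of_add_one (add_sub_cancel e' (1 : Module.End A (M i))) with
    h | h
  · right
    have hs := (Module.End.isUnit_iff _).1 h |>.2
    refine LinearMap.ext fun x => ?_
    obtain ⟨y, hy⟩ := hq x
    obtain ⟨z, rfl⟩ := hs y
    change e x = x
    rw [← hy, he2, hee]
  · left
    have hs := (Module.End.isUnit_iff _).1 h |>.2
    refine LinearMap.ext fun x => ?_
    obtain ⟨y, hy⟩ := hq x
    obtain ⟨z, rfl⟩ := hs y
    change e x = 0
    rw [← hy, LinearMap.sub_apply, Module.End.one_apply, map_sub, he2, map_sub, hee, sub_self]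

/-- The torsion free parts of a TF-admissible sequence of indecomposable modules that satisfy
`Extends d` and `ExtProj d` form a stratifying system. -/
theorem isStratifyingSystem_delta (hM : ∀ i, Extends d (M i)) (hM' : ∀ i, ExtProj d (M i))
    (hi : ∀ i, IsIndec A (M i)) (hF : ∀ i, ¬ Fac (tailSum M i) (M i)) :
    IsStratifyingSystem (Delta M) where
  finite i := inferInstance
  indecomposable i := indecomposable_of_isIndec (isIndec_delta hM hM' hi hF i)
  hom_eq_zero i j hij f := by
    have h := hom_delta_eq_zero hM hM' hij
      (f ∘ₗ (torsionPart (Fac (tailSum M j)) (M j)).mkQ)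
    ext x
    exact LinearMap.congr_fun h x
  ext_eq_zero i j hij := by
    refine subsingleton_ext_of_split _ _ fun Z _ _ q hq φ => ?_
    let S := torsionPart (Fac (tailSum M j)) (M j)
    -- The kernel of `q` is `Δ(i)`, a member of T, so `M j → Δ(j)` lifts to `Z`.
    obtain ⟨g, hg⟩ := hM' j q hq ((extends_delta hM i).congr φ) S.mkQ
    have hg' : ∀ x, q (g x) = S.mkQ x := fun x => LinearMap.congr_fun hg x
    -- On the torsion part the lift lands in `ker q ≅ Δ(i)`. This restriction is zero, since `S` is
    -- generated by the `M l` with `l > j ≥ i` and these have no maps to `Δ(i)`. Hence `g` descends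
    -- to a section.
    have hk : S ≤ LinearMap.ker g := fun x hx => by
      let w : ModuleCat.of A S →ₗ[A] Delta M i := φ.symm.toLinearMap ∘ₗ
        (g ∘ₗ S.subtype).codRestrict (LinearMap.ker q) fun y => by
          rw [LinearMap.mem_ker, LinearMap.comp_apply, hg', ← LinearMap.mem_ker, Submodule.ker_mkQ]
          exact y.2
      have hw : w = 0 := Fac.hom_eq_zero_of_tailSum (fac_torsionPart _ (M j))
        (fun l hl f => hom_delta_eq_zero hM hM' (hij.trans_lt hl) f) w
      have h0 := LinearMap.congr_fun hw ⟨x, hx⟩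
      simp only [w, LinearMap.comp_apply, LinearEquiv.coe_coe, LinearMap.zero_apply,
        LinearEquiv.map_eq_zero_iff] at h0
      exact congrArg Subtype.val h0
    refine ⟨S.liftQ g hk, LinearMap.ext fun x => ?_⟩
    obtain ⟨y, rfl⟩ := S.mkQ_surjective x
    simpa using hg' y

end Stratifying

open scoped ModuleCat

/-! ### The Auslander-Reiten formula and the Bongartz completion. -/

section Completion

variable {A : Type u} [Ring A]

/-- One half of the Auslander-Reiten formula: if there are no nonzero maps `M → τ M`, then
`Hom(P₀, M) → Hom(P₁, M)` is surjective. -/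
theorem MinProjPresentation.extends_of_hom_tau_eq_zero (k : Type u) [Field k] [Algebra k A]
    {M : ModuleCat.{u} A}
    (p : MinProjPresentation M) (h : ∀ f : M →ₗ[A] p.tau k, f = 0) : Extends p.d M := by
  let W : Submodule k (p.P₁ →ₗ[A] M) :=
    { carrier := {g | ∃ h : p.P₀ →ₗ[A] M, h ∘ₗ p.d = g}
      add_mem' := by
        rintro _ _ ⟨g, rfl⟩ ⟨g', rfl⟩
        exact ⟨g + g', LinearMap.add_comp _ _ _⟩
      zero_mem' := ⟨0, LinearMap.zero_comp _⟩
      smul_mem' := by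
        rintro c _ ⟨g, rfl⟩
        exact ⟨c • g, LinearMap.smul_comp _ _ _⟩ }
  suffices hW : W = ⊤ from fun g => (hW ▸ Submodule.mem_top : g ∈ W)
  by_contra hW
  -- A functional `l ≠ 0` killing every map that factors through `d` gives the map `m ↦ (f ↦ l (f(-)
  -- m))` from `M` to `ν P₁`; it lands in `τ M`, hence is zero.
  obtain ⟨l, hl0, hl⟩ := Submodule.exists_le_ker_of_lt_top W (lt_top_iff_ne_top.2 hW)
  let F₀ (m : M) : (p.P₁ →ₗ[A] A) →ₗ[k] k := l ∘ₗ
    { toFun := fun f => LinearMap.toSpanSingleton A M m ∘ₗ f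
      map_add' := fun f g => LinearMap.comp_add _ _ _
      map_smul' := fun c f => by ext x; simp }
  have hF₀ : ∀ m f, F₀ m f = l (LinearMap.toSpanSingleton A M m ∘ₗ f) := fun m f => rfl
  let F₁ : M →ₗ[A] Nakayama k A p.P₁ :=
    { toFun := fun m => (F₀ m : Module.Dual k (p.P₁ →ₗ[A] A))
      map_add' := fun m m' => Nakayama.ext fun f => by
        change F₀ (m + m') f = F₀ m f + F₀ m' f
        rw [hF₀, hF₀, hF₀, ← map_add]
        congr 1
        ext x
        simp
      map_smul' := fun a m => Nakayama.ext fun f => by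
        change F₀ (a • m) f = F₀ m (MulOpposite.op a • f)
        rw [hF₀, hF₀]
        congr 1
        ext x
        simp [mul_smul] }
  let F : M →ₗ[A] p.tau k := F₁.codRestrict _ fun m => by
    refine Nakayama.ext fun f => ?_
    change l (LinearMap.toSpanSingleton A M m ∘ₗ (f ∘ₗ p.d)) = 0
    exact hl ⟨LinearMap.toSpanSingleton A M m ∘ₗ f, LinearMap.comp_assoc _ _ _⟩
  have hF : ∀ m (f : p.P₁ →ₗ[A] A), l (LinearMap.toSpanSingleton A M m ∘ₗ f) = 0 := fun m f => by
    have h1 : F₁ m = 0 := congrArg Subtype.val (LinearMap.congr_fun (h F) m)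
    exact congrArg (fun φ => Nakayama.eval φ f) h1
  refine hl0 (LinearMap.ext fun g => ?_)
  have := p.projective₁
  have := p.finite₁
  obtain ⟨n, q, hq⟩ := Module.Finite.exists_fin' A p.P₁
  obtain ⟨s, hs⟩ := Module.projective_lifting_property q LinearMap.id hq
  -- By a dual basis of the finitely generated projective `P₁`, every `g` is a sum of maps `f(-) m`,
  -- on all of which `l` vanishes.
  have hg : g = ∑ i, LinearMap.toSpanSingleton A M (g (q (Pi.single i 1))) ∘ₗ
      (LinearMap.proj i ∘ₗ s) := by
    ext x
    have hx : q (s x) = x := LinearMap.congr_fun hs x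
    simp only [LinearMap.sum_apply, LinearMap.comp_apply, LinearMap.toSpanSingleton_apply,
      LinearMap.proj_apply, ← map_smul, ← map_sum]
    conv_lhs => rw [← hx]
    congr 2
    exact pi_eq_sum_univ' (s x)
  rw [hg, map_sum]
  exact Finset.sum_eq_zero fun i _ => hF _ _

theorem finite_hom (k : Type u) [Field k] [Algebra k A]
    [FiniteDimensional k A] (N X : ModuleCat.{u} A) [Module.Finite A N] [Module.Finite A X] :
    Module.Finite k (N →ₗ[A] X) := by
  have : Module.Finite k N := Module.Finite.trans A N
  have : Module.Finite k X := Module.Finite.trans A X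
  exact Module.Finite.of_injective (LinearMap.restrictScalarsₗ k A N X k)
    (LinearMap.restrictScalars_injective k)

theorem exists_spanning_family (k : Type u) [Field k] [Algebra k A]
    [FiniteDimensional k A] (N X : ModuleCat.{u} A) [Module.Finite A N] [Module.Finite A X] :
    ∃ (m : ℕ) (v : Fin m → (N →ₗ[A] X)), ∀ g, ∃ c : Fin m → k, ∑ l, c l • v l = g := by
  have := finite_hom k N X
  obtain ⟨m, v, hv⟩ := Module.Finite.exists_fin (R := k) (M := N →ₗ[A] X)
  exact ⟨m, v, fun g => (Submodule.mem_span_range_iff_exists_fun k).1 (hv ▸ Submodule.mem_top)⟩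

/-- The Bongartz completion: the universal extension `R → E → M^m → 0` of a projective module `R`
by copies of the `τ`-rigid module `M`. -/
theorem MinProjPresentation.exists_universal_extension (k : Type u) [Field k] [Algebra k A]
    [FiniteDimensional k A] {M : ModuleCat.{u} A}
    (p : MinProjPresentation M) (hM : Extends p.d M) (R : ModuleCat.{u} A)
    [Module.Projective A R] [Module.Finite A R] :
    ∃ (E : ModuleCat.{u} A) (m : ℕ) (i : R →ₗ[A] E) (q : E →ₗ[A] (Fin m → M)),
      Module.Finite A E ∧ Extends p.d E ∧ ExtProj p.d E ∧ Function.Surjective q ∧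
      LinearMap.range i = LinearMap.ker q ∧
      (∀ (X : Type u) [AddCommGroup X] [Module A X], Extends p.d X →
        ∀ g : R →ₗ[A] X, ∃ g' : E →ₗ[A] X, g' ∘ₗ i = g) ∧
      (IsLocalRing (Module.End A R) → i ≠ 0) := by
  have := p.projective₁
  have := p.projective₀
  have := p.finite₁
  have := p.finite₀
  obtain ⟨m, v, hv⟩ := exists_spanning_family k p.P₁ R
  have : Module.Projective A (Fin m → p.P₀) :=
    Module.Projective.of_equiv
      (DFinsupp.linearEquivFunOnFintype (R := A) (M := fun _ : Fin m => p.P₀))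
  let d' : (Fin m → p.P₁) →ₗ[A] (Fin m → p.P₀) := LinearMap.pi fun l => p.d ∘ₗ LinearMap.proj l
  let v' : (Fin m → p.P₁) →ₗ[A] R := ∑ l, v l ∘ₗ LinearMap.proj l
  have hv' : ∀ x, v' x = ∑ l, v l (x l) := fun x => by simp [v']
  -- `E` is the cokernel of `δ`, the pushout of `d^m` along all of a spanning family `v` of `Hom(P₁,
  -- R)`.
  let δ := d'.prod v'
  have hd' : ∀ (X : Type u) [AddCommGroup X] [Module A X], Extends p.d X →
      ∀ w : (Fin m → p.P₁) →ₗ[A] X, ∃ z : (Fin m → p.P₀) →ₗ[A] X, z ∘ₗ d' = w := by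
    intro X _ _ hX w
    choose z hz using fun l => hX (w ∘ₗ LinearMap.single A (fun _ => (p.P₁ : Type u)) l)
    refine ⟨∑ l, z l ∘ₗ LinearMap.proj l, LinearMap.ext fun x => ?_⟩
    have hz' : ∀ l, z l (p.d (x l)) = w (Pi.single l (x l)) :=
      fun l => LinearMap.congr_fun (hz l) (x l)
    simp only [LinearMap.comp_apply, LinearMap.sum_apply, LinearMap.proj_apply, d',
      LinearMap.pi_apply, hz', ← map_sum]
    rw [Finset.univ_sum_single]
  let S := LinearMap.range δ
  have hδS : ∀ x, S.mkQ (d' x, v' x) = 0 := fun x => by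
    rw [Submodule.mkQ_apply, Submodule.Quotient.mk_eq_zero]
    exact ⟨x, rfl⟩
  let q₀ : ((Fin m → p.P₀) × R) →ₗ[A] (Fin m → M) :=
    (LinearMap.pi fun l => p.π ∘ₗ LinearMap.proj l) ∘ₗ LinearMap.fst A _ _
  have hπd : ∀ x, p.π (p.d x) = 0 := fun x =>
    LinearMap.mem_ker.1 (p.exact ▸ LinearMap.mem_range_self p.d x)
  have hq₀ : S ≤ LinearMap.ker q₀ := by
    rintro _ ⟨x, rfl⟩
    ext l
    simp [q₀, δ, d', hπd]
  refine ⟨ModuleCat.of A (((Fin m → p.P₀) × R) ⧸ S), m, S.mkQ ∘ₗ LinearMap.inr A _ _,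
    S.liftQ q₀ hq₀, inferInstance, ?_, ?_, ?_, ?_, ?_, ?_⟩
  · intro g
    obtain ⟨G, hG⟩ := Module.projective_lifting_property S.mkQ g S.mkQ_surjective
    obtain ⟨c, hc⟩ := hv (LinearMap.snd A _ _ ∘ₗ G)
    -- The scalars `c` express the `R`-component of `G` through `v`. Modulo `range d` the remainder
    -- is a map `P₁ → M`, which factors through `d` because `M` is in T.
    have key : ∀ l, ∃ (h : p.P₀ →ₗ[A] p.P₀) (e : p.P₁ →ₗ[A] p.P₁),
        ∀ x, (G x).1 l = c l • p.d x + h (p.d x) + p.d (e x) := by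
      intro l
      let u := LinearMap.proj l ∘ₗ LinearMap.fst A _ _ ∘ₗ G - c l • p.d
      obtain ⟨h, hh⟩ := hM (p.π ∘ₗ u)
      obtain ⟨h', rfl⟩ := Module.projective_lifting_property p.π h p.surjective_π
      have hu : ∀ x, (u - h' ∘ₗ p.d) x ∈ LinearMap.range p.d := fun x => by
        rw [p.exact, LinearMap.mem_ker, LinearMap.sub_apply, map_sub, sub_eq_zero]
        exact (LinearMap.congr_fun hh x).symm
      obtain ⟨e, he⟩ := Module.projective_lifting_property p.d.rangeRestrict
        ((u - h' ∘ₗ p.d).codRestrict _ hu) p.d.surjective_rangeRestrict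
      refine ⟨h', e, fun x => ?_⟩
      have : p.d (e x) = (u - h' ∘ₗ p.d) x := congrArg Subtype.val (LinearMap.congr_fun he x)
      rw [this]
      simp [u]
    choose h e he using key
    -- Subtracting `δ (c x + e x - c' x)` cancels the `R`-component of `G x`, because `c'` absorbs
    -- the contribution of `e`; what is left factors through `d`.
    obtain ⟨c', hc'⟩ := hv (∑ l, v l ∘ₗ e l)
    refine ⟨S.mkQ ∘ₗ LinearMap.inl A _ _ ∘ₗ LinearMap.pi fun l => h l + c' l • LinearMap.id,
      LinearMap.ext fun x => ?_⟩
    rw [← hG, eq_comm, ← sub_eq_zero]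
    simp only [LinearMap.comp_apply]
    rw [← map_sub, ← hδS fun l => c l • x + e l x - c' l • x]
    congr 1
    ext l
    · simp [d', he, LinearMap.map_smul_of_tower]
      abel
    · have h1 : ∑ l, c l • v l x = (G x).2 := by simpa using LinearMap.congr_fun hc x
      have h2 : ∑ l, c' l • v l x = ∑ l, v l (e l x) := by simpa using LinearMap.congr_fun hc' x
      simp [hv', LinearMap.map_smul_of_tower, Finset.sum_add_distrib, h1, h2]
  · refine ExtProj.of_presentation δ S.mkQ S.mkQ_surjective (Submodule.ker_mkQ S).symm ?_
    intro X _ _ hX w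
    obtain ⟨z, hz⟩ := hd' X hX w
    exact ⟨z ∘ₗ LinearMap.fst A _ _, hz⟩
  · intro y
    choose x hx using fun l => p.surjective_π (y l)
    refine ⟨S.mkQ (x, 0), ?_⟩
    ext l
    simp [q₀, hx]
  · refine le_antisymm ?_ fun y hy => ?_
    · rintro _ ⟨r, rfl⟩
      ext l
      simp [q₀]
    · obtain ⟨⟨u, r⟩, rfl⟩ := S.mkQ_surjective y
      have hu : ∀ l, ∃ x, p.d x = u l := fun l => by
        have : p.π (u l) = 0 := congrFun hy l
        exact (p.exact ▸ LinearMap.mem_ker.2 this : u l ∈ LinearMap.range p.d)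
      choose x hx using hu
      refine ⟨r - v' x, ?_⟩
      have : d' x = u := funext hx
      rw [LinearMap.comp_apply, LinearMap.inr_apply, eq_comm, ← sub_eq_zero, ← map_sub,
        ← hδS x, this]
      simp
  · intro X _ _ hX g
    obtain ⟨z, hz⟩ := hd' X hX (g ∘ₗ v')
    refine ⟨S.liftQ (g ∘ₗ LinearMap.snd A _ _ - z ∘ₗ LinearMap.fst A _ _) ?_, ?_⟩
    · rintro _ ⟨x, rfl⟩
      have : z (d' x) = g (v' x) := LinearMap.congr_fun hz x
      simp [δ, this]
    · ext r
      simp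
  · intro hR hi
    have hmem : ∀ r : R, ((0 : Fin m → p.P₀), r) ∈ LinearMap.range δ := fun r => by
      have := LinearMap.congr_fun hi r
      rwa [LinearMap.comp_apply, LinearMap.zero_apply, Submodule.mkQ_apply,
        Submodule.Quotient.mk_eq_zero] at this
    -- If `i = 0`, then `R` lies in the image of `δ`, and projectivity gives `ψ : R → P₁^m` with `d'
    -- ψ = 0` and `v' ψ = 1`. Locality makes one summand `v l ∘ ψ_l` a unit.
    obtain ⟨ψ, hψ⟩ := Module.projective_lifting_property δ.rangeRestrict
      ((LinearMap.inr A (Fin m → p.P₀) R).codRestrict _ hmem) δ.surjective_rangeRestrict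
    have hψ' : ∀ r, (d' (ψ r), v' (ψ r)) = (0, r) := fun r =>
      congrArg Subtype.val (LinearMap.congr_fun hψ r)
    have hψd : ∀ r l, p.d (ψ r l) = 0 := fun r l => congrFun (congrArg Prod.fst (hψ' r)) l
    have hsum : ∑ l, (v l ∘ₗ LinearMap.proj l ∘ₗ ψ : Module.End A R) = 1 := by
      ext r
      have h1 := congrArg Prod.snd (hψ' r)
      rw [hv'] at h1
      simpa using h1
    obtain ⟨l, -, hl⟩ := IsLocalRing.exists_of_isUnit_sum (hsum ▸ isUnit_one)
    obtain ⟨w, hw⟩ := hl.exists_right_inv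
    have hw' : ∀ r, v l (ψ (w r) l) = r := fun r => LinearMap.congr_fun hw r
    -- Minimality of the presentation enters here: `ker (v l) + ker d = P₁` with `ker d` superfluous
    -- forces `v l = 0`.
    have hker : LinearMap.ker (v l) = ⊤ := by
      refine p.superfluous_ker_d _ (eq_top_iff.2 fun x _ => ?_)
      refine Submodule.mem_sup.2 ⟨x - ψ (w (v l x)) l, ?_, ψ (w (v l x)) l, hψd _ _, by abel⟩
      simp [hw']
    rw [LinearMap.ker_eq_top] at hker
    refine hl.ne_zero ?_
    rw [hker, LinearMap.zero_comp]

/-- In the torsion class of a `τ`-rigid module `M`, a relatively projective module `N` generated by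
a module `U` that has `M` as a direct summand is a direct summand of a power of `U`. -/
theorem MinProjPresentation.exists_retract_of_fac (k : Type u) [Field k] [Algebra k A]
    [FiniteDimensional k A] {M : ModuleCat.{u} A}
    (p : MinProjPresentation M) {U N : ModuleCat.{u} A}
    [Module.Finite A U] (hN : ExtProj p.d N) (hU : Extends p.d U) (s : M →ₗ[A] U)
    (r : U →ₗ[A] M) (hrs : r ∘ₗ s = LinearMap.id) (hF : Fac U N) :
    ∃ (m : ℕ) (s' : N →ₗ[A] (Fin m → U)) (r' : (Fin m → U) →ₗ[A] N),
      r' ∘ₗ s' = LinearMap.id := by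
  have := p.projective₀
  obtain ⟨hNf, n, f, hf⟩ := hF
  obtain ⟨m, v, hv⟩ := exists_spanning_family k U N
  -- Every map `U → N` factors through `w`, since `v` spans `Hom(U, N)`; as `U` generates `N`, `w`
  -- is onto.
  let w : (Fin m → U) →ₗ[A] N := ∑ l, v l ∘ₗ LinearMap.proj l
  have hw : ∀ x, w x = ∑ l, v l (x l) := fun x => by simp [w]
  have hfac : ∀ g : U →ₗ[A] N, ∃ g' : U →ₗ[A] (Fin m → U), w ∘ₗ g' = g := fun g => by
    obtain ⟨c, rfl⟩ := hv g
    refine ⟨LinearMap.pi fun l => c l • LinearMap.id, LinearMap.ext fun x => ?_⟩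
    simp [hw, LinearMap.map_smul_of_tower]
  have hws : Function.Surjective w := by
    rw [← LinearMap.range_eq_top, eq_top_iff, ← LinearMap.range_eq_top.2 hf]
    rintro _ ⟨x, rfl⟩
    have : f x = ∑ i, (f ∘ₗ LinearMap.single A (fun _ => (U : Type u)) i) (x i) := by
      simp only [LinearMap.comp_apply, LinearMap.single_apply, ← map_sum]
      rw [Finset.univ_sum_single]
    rw [this]
    refine Submodule.sum_mem _ fun i _ => ?_
    obtain ⟨g', hg'⟩ := hfac (f ∘ₗ LinearMap.single A (fun _ => (U : Type u)) i)
    rw [← hg']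
    exact ⟨_, rfl⟩
  -- A Wakamatsu-type argument: extend `g` to `z : P₀ → U^m`. Then `w ∘ z` induces `a : M → N`, and
  -- `a ∘ r` factors through `w` by some `b`; the correction `z - b s π` lands in `ker w` and still
  -- extends `g`.
  have hk : Extends p.d (LinearMap.ker w) := by
    intro g
    obtain ⟨z, hz⟩ := Extends.pi (fun _ : Fin m => hU) (LinearEquiv.refl A _)
      ((LinearMap.ker w).subtype ∘ₗ g)
    have hz' : ∀ x, z (p.d x) = g x := fun x => LinearMap.congr_fun hz x
    have hle : LinearMap.ker p.π ≤ LinearMap.ker (w ∘ₗ z) := by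
      rw [← p.exact]
      rintro _ ⟨x, rfl⟩
      simp [hz']
    let φ := p.π.quotKerEquivOfSurjective p.surjective_π
    let a : M →ₗ[A] N := (LinearMap.ker p.π).liftQ _ hle ∘ₗ φ.symm.toLinearMap
    have ha : ∀ x, a (p.π x) = w (z x) := fun x => by
      have : φ.symm (p.π x) = (LinearMap.ker p.π).mkQ x := by
        rw [LinearEquiv.symm_apply_eq]; rfl
      simp [a, this]
    obtain ⟨b, hb⟩ := hfac (a ∘ₗ r)
    have hb' : ∀ x, w (b (s x)) = a x := fun x => by
      have h1 := LinearMap.congr_fun hb (s x)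
      have h2 : r (s x) = x := LinearMap.congr_fun hrs x
      simpa [h2] using h1
    refine ⟨(z - b ∘ₗ s ∘ₗ p.π).codRestrict _ fun x => by simp [ha, hb'],
      LinearMap.ext fun x => Subtype.ext ?_⟩
    have : p.π (p.d x) = 0 := LinearMap.mem_ker.1 (p.exact ▸ LinearMap.mem_range_self p.d x)
    simp [this, hz']
  obtain ⟨s', hs'⟩ := hN w hws hk LinearMap.id
  exact ⟨m, s', w, hs'⟩

end Completion

/-! ### Dimensions of Hom spaces along exact sequences. -/

section HomDim

variable (k : Type u) {A : Type u} [Field k] [Ring A] [Algebra k A]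

/-- The dimension of `Hom_A(N, X)` over `k`. -/
noncomputable def homDim (N X : ModuleCat.{u} A) : ℚ := Module.finrank k (N →ₗ[A] X)

theorem homDim_congr_left {N N' : ModuleCat.{u} A} (φ : N ≃ₗ[A] N') (X : ModuleCat.{u} A) :
    homDim k N X = homDim k N' X := by
  let e : (N →ₗ[A] X) ≃ₗ[k] (N' →ₗ[A] X) :=
    { toFun := fun f => f ∘ₗ φ.symm.toLinearMap
      invFun := fun f => f ∘ₗ φ.toLinearMap
      left_inv := fun f => by ext; simp
      right_inv := fun f => by ext; simp
      map_add' := fun f g => LinearMap.add_comp _ _ _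
      map_smul' := fun c f => LinearMap.smul_comp _ _ _ }
  exact congrArg Nat.cast e.finrank_eq

theorem homDim_eq_zero {N X : ModuleCat.{u} A} (h : ∀ f : N →ₗ[A] X, f = 0) :
    homDim k N X = 0 := by
  have : Subsingleton (N →ₗ[A] X) := subsingleton_of_forall_eq 0 h
  rw [homDim, Module.finrank_zero_of_subsingleton, Nat.cast_zero]

variable [FiniteDimensional k A]

theorem homDim_ne_zero {N X : ModuleCat.{u} A} [Module.Finite A N] [Module.Finite A X]
    {f : N →ₗ[A] X} (hf : f ≠ 0) : homDim k N X ≠ 0 := by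
  have := finite_hom k N X
  have : Nontrivial (N →ₗ[A] X) := nontrivial_of_ne f 0 hf
  exact Nat.cast_ne_zero.2 Module.finrank_pos.ne'

theorem homDim_pi {ι : Type} [Fintype ι] (U : ι → ModuleCat.{u} A) [∀ i, Module.Finite A (U i)]
    (X : ModuleCat.{u} A) [Module.Finite A X] :
    homDim k (ModuleCat.of A (∀ i, U i)) X = ∑ i, homDim k (U i) X := by
  classical
  have := fun i => finite_hom k (U i) X
  have h := (LinearMap.lsum A (fun i => (U i : Type u)) (M := X) k).finrank_eq
  rw [Module.finrank_pi_fintype] at h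
  simp only [homDim]
  exact_mod_cast h.symm

theorem homDim_eq_add_of_lift {X Y Z N : ModuleCat.{u} A} [Module.Finite A N]
    [Module.Finite A Z] (i : X →ₗ[A] Z) (hi : Function.Injective i) (q : Z →ₗ[A] Y)
    (hq : LinearMap.range i = LinearMap.ker q)
    (h : ∀ g : N →ₗ[A] Y, ∃ g' : N →ₗ[A] Z, q ∘ₗ g' = g) :
    homDim k N Z = homDim k N X + homDim k N Y := by
  have := finite_hom k N Z
  let α : (N →ₗ[A] X) →ₗ[k] (N →ₗ[A] Z) :=
    { toFun := fun f => i ∘ₗ f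
      map_add' := fun f g => LinearMap.comp_add _ _ _
      map_smul' := fun c f => by ext x; simp [LinearMap.map_smul_of_tower] }
  let β : (N →ₗ[A] Z) →ₗ[k] (N →ₗ[A] Y) :=
    { toFun := fun f => q ∘ₗ f
      map_add' := fun f g => LinearMap.comp_add _ _ _
      map_smul' := fun c f => by ext x; simp [LinearMap.map_smul_of_tower] }
  have hα : Function.Injective α := fun f g hfg => LinearMap.ext fun x =>
    hi (LinearMap.congr_fun hfg x)
  have hαβ : LinearMap.range α = LinearMap.ker β := by
    refine le_antisymm ?_ fun g hg => ?_
    · rintro _ ⟨f, rfl⟩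
      exact LinearMap.ext fun x =>
        (LinearMap.mem_ker.1 (hq ▸ LinearMap.mem_range_self i (f x)) : q (i (f x)) = 0)
    · have hg' : ∀ x, g x ∈ LinearMap.range i := fun x => by
        rw [hq]; exact LinearMap.congr_fun hg x
      refine ⟨(LinearEquiv.ofInjective i hi).symm.toLinearMap ∘ₗ g.codRestrict _ hg',
        LinearMap.ext fun x => ?_⟩
      exact congrArg Subtype.val
        ((LinearEquiv.ofInjective i hi).apply_symm_apply ⟨g x, hg' x⟩)
  have h1 := β.finrank_range_add_finrank_ker
  rw [LinearMap.range_eq_top.2 (fun g => h g), finrank_top, ← hαβ,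
    LinearMap.finrank_range_of_inj hα] at h1
  simp only [homDim]
  rw [add_comm]
  exact_mod_cast h1.symm

theorem homDim_eq_add_of_extend {R E C X : ModuleCat.{u} A} [Module.Finite A E]
    [Module.Finite A X] (i : R →ₗ[A] E) (q : E →ₗ[A] C) (hq : Function.Surjective q)
    (hiq : LinearMap.range i = LinearMap.ker q)
    (h : ∀ g : R →ₗ[A] X, ∃ g' : E →ₗ[A] X, g' ∘ₗ i = g) :
    homDim k E X = homDim k C X + homDim k R X := by
  have := finite_hom k E X
  let α : (C →ₗ[A] X) →ₗ[k] (E →ₗ[A] X) :=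
    { toFun := fun f => f ∘ₗ q
      map_add' := fun f g => LinearMap.add_comp _ _ _
      map_smul' := fun c f => LinearMap.smul_comp _ _ _ }
  let β : (E →ₗ[A] X) →ₗ[k] (R →ₗ[A] X) :=
    { toFun := fun f => f ∘ₗ i
      map_add' := fun f g => LinearMap.add_comp _ _ _
      map_smul' := fun c f => LinearMap.smul_comp _ _ _ }
  have hα : Function.Injective α := fun f g hfg => LinearMap.ext fun x => by
    obtain ⟨y, rfl⟩ := hq x
    exact LinearMap.congr_fun hfg y
  have hαβ : LinearMap.range α = LinearMap.ker β := by
    refine le_antisymm ?_ fun g hg => ?_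
    · rintro _ ⟨f, rfl⟩
      refine LinearMap.ext fun x => ?_
      have : q (i x) = 0 := LinearMap.mem_ker.1 (hiq ▸ LinearMap.mem_range_self i x)
      simp [α, β, this]
    · have hk : LinearMap.ker q ≤ LinearMap.ker g := by
        rw [← hiq]
        rintro _ ⟨x, rfl⟩
        exact LinearMap.congr_fun hg x
      let φ := q.quotKerEquivOfSurjective hq
      refine ⟨(LinearMap.ker q).liftQ g hk ∘ₗ φ.symm.toLinearMap, LinearMap.ext fun x => ?_⟩
      have : φ.symm (q x) = (LinearMap.ker q).mkQ x := by
        rw [LinearEquiv.symm_apply_eq]; rfl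
      simp [α, this]
  have h1 := β.finrank_range_add_finrank_ker
  rw [LinearMap.range_eq_top.2 (fun g => h g), finrank_top, ← hαβ,
    LinearMap.finrank_range_of_inj hα] at h1
  simp only [homDim]
  rw [add_comm]
  exact_mod_cast h1.symm

end HomDim

/-! ### Indecomposable projectives and their simple tops. -/

section ProjectiveIndecomposable

variable {A : Type u} [Ring A]

/-- An indecomposable projective module has at most one maximal submodule. -/
theorem eq_of_isCoatom {P : Type u} [AddCommGroup P] [Module A P] [Module.Projective A P]
    [IsLocalRing (Module.End A P)] {K L : Submodule A P} (hK : IsCoatom K) (hL : IsCoatom L) :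
    K = L := by
  by_contra hKL
  have hsup : K ⊔ L = ⊤ := hK.sup_eq_top_of_ne hL hKL
  -- If `K ≠ L`, then `K × L → P` is onto and splits, so the identity is a sum of endomorphisms with
  -- images in `K` and in `L`; by locality one is onto.
  obtain ⟨s, hs⟩ := Module.projective_lifting_property (K.subtype.coprod L.subtype) LinearMap.id
    (LinearMap.range_eq_top.1 (by
      rw [LinearMap.range_coprod, Submodule.range_subtype, Submodule.range_subtype, hsup]))
  have key : ∀ (S : Submodule A P) (f : P →ₗ[A] S), IsCoatom S →
      ¬ IsUnit (S.subtype ∘ₗ f : Module.End A P) := fun S f hS h => by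
    refine hS.1 (eq_top_iff.2 fun x _ => ?_)
    obtain ⟨y, rfl⟩ := ((Module.End.isUnit_iff _).1 h).2 x
    exact (f y).2
  rcases IsLocalRing.isUnit_or_isUnit_of_add_one
    (a := (K.subtype ∘ₗ LinearMap.fst A K L ∘ₗ s : Module.End A P))
    (b := (L.subtype ∘ₗ LinearMap.snd A K L ∘ₗ s : Module.End A P)) (by
      ext x
      exact LinearMap.congr_fun hs x) with h | h
  exacts [key _ _ hK h, key _ _ hL h]

/-- The image of `g` is the simple top of `P`. A map to it from `Q` lifts to `Q → P`; the lift is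
not onto as `P ≇ Q`, so its image lies in the only maximal submodule `ker g`. -/
theorem eq_zero_of_isCoatom_ker {P Q X : Type u} [AddCommGroup P] [Module A P]
    [AddCommGroup Q] [Module A Q] [AddCommGroup X] [Module A X] [Module.Projective A P]
    [Module.Projective A Q] [Module.Finite A P] [IsLocalRing (Module.End A P)]
    (hP : IsIndec A P) (hQ : IsIndec A Q) (hPQ : IsEmpty (P ≃ₗ[A] Q)) (g : P →ₗ[A] X)
    (hg : IsCoatom (LinearMap.ker g)) (f : Q →ₗ[A] LinearMap.range g) : f = 0 := by
  obtain ⟨f', rfl⟩ := Module.projective_lifting_property g.rangeRestrict f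
    g.surjective_rangeRestrict
  rcases IsCoatomic.eq_top_or_exists_le_coatom (LinearMap.range f') with h | ⟨K, hK, hle⟩
  · obtain ⟨s, hs⟩ := Module.projective_lifting_property f' LinearMap.id
      (LinearMap.range_eq_top.1 h)
    have := hP.1
    exact hPQ.elim (LinearEquiv.ofBijective s (hQ.bijective_of_retract s f' hs))
  · rw [eq_of_isCoatom hK hg] at hle
    ext x
    exact hle ⟨x, rfl⟩

/-- Dividing `X` by the image of a maximal submodule containing `ker g` stays in the torsion class
and makes the image of `P` simple. -/
theorem exists_isCoatom_ker {P₁ P₀ P : Type u} [AddCommGroup P₁] [Module A P₁] [AddCommGroup P₀]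
    [Module A P₀] [AddCommGroup P] [Module A P] {d : P₁ →ₗ[A] P₀} [Module.Projective A P₁]
    [Module.Finite A P] {X : ModuleCat.{u} A} [Module.Finite A X] (hX : Extends d X)
    {g : P →ₗ[A] X} (hg : g ≠ 0) :
    ∃ (Y : ModuleCat.{u} A) (g' : P →ₗ[A] Y), Module.Finite A Y ∧ Extends d Y ∧
      IsCoatom (LinearMap.ker g') := by
  rcases IsCoatomic.eq_top_or_exists_le_coatom (LinearMap.ker g) with h | ⟨K, hK, hle⟩
  · exact absurd (LinearMap.ker_eq_top.1 h) hg
  · refine ⟨ModuleCat.of A (X ⧸ K.map g), (K.map g).mkQ ∘ₗ g, inferInstance,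
      hX.of_surjective _ (Submodule.mkQ_surjective _), ?_⟩
    rwa [LinearMap.ker_comp, Submodule.ker_mkQ, Submodule.comap_map_eq, sup_eq_left.2 hle]

end ProjectiveIndecomposable

/-! ### Additive functions on the torsion class. -/

section Additive

variable {A : Type u} [Ring A] {P₁ P₀ : Type u} [AddCommGroup P₁] [Module A P₁] [AddCommGroup P₀]
  [Module A P₀]

/-- The torsion class of finitely generated modules with `Extends d`. -/
abbrev TorsionClass (d : P₁ →ₗ[A] P₀) : Type (u + 1) :=
  {X : ModuleCat.{u} A // Module.Finite A X ∧ Extends d X}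

/-- Additivity of a function on a torsion class with respect to short exact sequences. -/
def IsAdditive {d : P₁ →ₗ[A] P₀} (e : TorsionClass d → ℚ) : Prop :=
  ∀ (X Z Y : TorsionClass d) (i : X.1 →ₗ[A] Z.1) (q : Z.1 →ₗ[A] Y.1), Function.Injective i →
    Function.Surjective q → LinearMap.range i = LinearMap.ker q → e Z = e X + e Y

variable {d : P₁ →ₗ[A] P₀}

theorem IsAdditive.eq_zero {e : TorsionClass d → ℚ} (he : IsAdditive e) (X : TorsionClass d)
    [Subsingleton X.1] : e X = 0 := by
  have := he X X X 0 0 (Function.injective_of_subsingleton _)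
    (fun x => ⟨x, Subsingleton.elim _ _⟩) (Subsingleton.elim _ _)
  linarith

theorem IsAdditive.sum_smul {ι : Type*} [Fintype ι] {e : ι → TorsionClass d → ℚ}
    (he : ∀ i, IsAdditive (e i)) (c : ι → ℚ) : IsAdditive (∑ j, c j • e j) := by
  intro X Z Y i q hi hq hiq
  simp only [Finset.sum_apply, Pi.smul_apply, smul_eq_mul, ← Finset.sum_add_distrib, ← mul_add]
  exact Finset.sum_congr rfl fun j _ => by rw [he j X Z Y i q hi hq hiq]

theorem isAdditive_homDim (k : Type u) [Field k] [Algebra k A] [FiniteDimensional k A]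
    {N : ModuleCat.{u} A} [Module.Finite A N] (hN : ExtProj d N) :
    IsAdditive fun X : TorsionClass d => homDim k N X.1 := by
  intro X Z Y i q hi hq hiq
  have := Z.2.1
  refine homDim_eq_add_of_lift k i hi q hiq (hN q hq ?_)
  rw [← hiq]
  exact X.2.2.congr (LinearEquiv.ofInjective i hi)

variable [Module.Projective A P₁]

/-- The change of an additive function upon dividing out the image of a map from `P` depends
only on the kernel of that map. -/
theorem IsAdditive.add_eq_add {e : TorsionClass d → ℚ} (he : IsAdditive e)
    {P : Type u} [AddCommGroup P] [Module A P] {X X' C C' : TorsionClass d}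
    (g : P →ₗ[A] X.1) (g' : P →ₗ[A] X'.1) (hgg' : LinearMap.ker g = LinearMap.ker g')
    (q : X.1 →ₗ[A] C.1) (hq : Function.Surjective q) (hgq : LinearMap.range g = LinearMap.ker q)
    (q' : X'.1 →ₗ[A] C'.1) (hq' : Function.Surjective q')
    (hgq' : LinearMap.range g' = LinearMap.ker q') : e X + e C' = e X' + e C := by
  have := X.2.1
  have := X'.2.1
  -- The pushout `Z` of `g` and `g'` is an extension of `C'` by `X` and also of `C` by `X'`;
  -- injectivity on each side uses the equality of kernels.
  let S : Submodule A (X.1 × X'.1) := LinearMap.range (g.prod g')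
  have hqg : ∀ x, q (g x) = 0 := fun x => LinearMap.mem_ker.1 (hgq ▸ LinearMap.mem_range_self g x)
  have hqg' : ∀ x, q' (g' x) = 0 :=
    fun x => LinearMap.mem_ker.1 (hgq' ▸ LinearMap.mem_range_self g' x)
  let Z : TorsionClass d := ⟨ModuleCat.of A ((X.1 × X'.1) ⧸ S), inferInstance,
    (X.2.2.prod X'.2.2).of_surjective _ S.mkQ_surjective⟩
  have h1 : e Z = e X + e C' := by
    refine he X Z C' (S.mkQ ∘ₗ LinearMap.inl A _ _) (S.liftQ (q' ∘ₗ LinearMap.snd A _ _) ?_)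
      ((injective_iff_map_eq_zero _).2 fun x hx => ?_) (fun y => ?_)
      (le_antisymm ?_ fun z hz => ?_)
    · rintro _ ⟨x, rfl⟩
      simp [hqg']
    · rw [LinearMap.comp_apply, Submodule.mkQ_apply, Submodule.Quotient.mk_eq_zero] at hx
      obtain ⟨y, hy⟩ := hx
      have h2 : g' y = 0 := congrArg Prod.snd hy
      rw [← LinearMap.mem_ker, ← hgg'] at h2
      exact (congrArg Prod.fst hy).symm.trans h2
    · obtain ⟨x, rfl⟩ := hq' y
      exact ⟨S.mkQ (0, x), rfl⟩
    · rintro _ ⟨x, rfl⟩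
      exact (map_zero q' : q' 0 = 0)
    · obtain ⟨⟨x, x'⟩, rfl⟩ := S.mkQ_surjective z
      have hx' : x' ∈ LinearMap.ker q' := hz
      rw [← hgq'] at hx'
      obtain ⟨y, rfl⟩ := hx'
      refine ⟨x - g y, ?_⟩
      rw [LinearMap.comp_apply, ← sub_eq_zero, ← map_sub, Submodule.mkQ_apply,
        Submodule.Quotient.mk_eq_zero]
      exact ⟨-y, by simp⟩
  have h2 : e Z = e X' + e C := by
    refine he X' Z C (S.mkQ ∘ₗ LinearMap.inr A _ _) (S.liftQ (q ∘ₗ LinearMap.fst A _ _) ?_)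
      ((injective_iff_map_eq_zero _).2 fun x hx => ?_) (fun y => ?_)
      (le_antisymm ?_ fun z hz => ?_)
    · rintro _ ⟨x, rfl⟩
      simp [hqg]
    · rw [LinearMap.comp_apply, Submodule.mkQ_apply, Submodule.Quotient.mk_eq_zero] at hx
      obtain ⟨y, hy⟩ := hx
      have h2 : g y = 0 := congrArg Prod.fst hy
      rw [← LinearMap.mem_ker, hgg'] at h2
      exact (congrArg Prod.snd hy).symm.trans h2
    · obtain ⟨x, rfl⟩ := hq y
      exact ⟨S.mkQ (x, 0), rfl⟩
    · rintro _ ⟨x, rfl⟩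
      exact (map_zero q : q 0 = 0)
    · obtain ⟨⟨x, x'⟩, rfl⟩ := S.mkQ_surjective z
      have hx : x ∈ LinearMap.ker q := hz
      rw [← hgq] at hx
      obtain ⟨y, rfl⟩ := hx
      refine ⟨x' - g' y, ?_⟩
      rw [LinearMap.comp_apply, ← sub_eq_zero, ← map_sub, Submodule.mkQ_apply,
        Submodule.Quotient.mk_eq_zero]
      exact ⟨-y, by simp⟩
  rw [← h1, h2]

end Additive

/-! ### Counting a relatively projective sequence by linear algebra. -/

section Count

variable {A : Type u} [Ring A]

/-- If `A` is a product of copies of the modules `P i` then a nonzero artinian module contains a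
simple submodule that is the image of one of the `P i`. -/
theorem exists_isAtom_range {n : ℕ} {P : Fin n → ModuleCat.{u} A} {ι : Type} [Finite ι]
    {σ : ι → Fin n} (φ : A ≃ₗ[A] ∀ j, P (σ j)) (C : Type u) [AddCommGroup C] [Module A C]
    [IsArtinian A C] [Nontrivial C] :
    ∃ (i : Fin n) (g : P i →ₗ[A] C), IsAtom (LinearMap.range g) ∧ IsCoatom (LinearMap.ker g) := by
  classical
  obtain ⟨S, hS, -⟩ :=
    (IsAtomic.eq_bot_or_exists_atom_le (⊤ : Submodule A C)).resolve_left top_ne_bot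
  obtain ⟨x, hxS, hx0⟩ := (Submodule.ne_bot_iff _).1 hS.1
  -- The map `1 ↦ x` is nonzero on some summand of `A`, and its image there is the simple module
  -- `S`.
  let f : (∀ j, P (σ j)) →ₗ[A] C := LinearMap.toSpanSingleton A C x ∘ₗ φ.symm.toLinearMap
  have hf : ∃ j, f ∘ₗ LinearMap.single A (fun j => (P (σ j) : Type u)) j ≠ 0 := by
    by_contra! h
    have h0 : f = 0 := LinearMap.pi_ext' h
    have := LinearMap.congr_fun h0 (φ 1)
    simp [f] at this
    exact hx0 this
  obtain ⟨j, hj⟩ := hf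
  have hr : LinearMap.range (f ∘ₗ LinearMap.single A (fun j => (P (σ j) : Type u)) j) = S := by
    refine (hS.le_iff.1 ?_).resolve_left (fun h => hj (LinearMap.range_eq_bot.1 h))
    rintro _ ⟨y, rfl⟩
    exact S.smul_mem _ hxS
  refine ⟨σ j, _, hr ▸ hS, ?_⟩
  rw [← isSimpleModule_iff_isCoatom]
  rw [← hr, ← isSimpleModule_iff_isAtom] at hS
  exact IsSimpleModule.congr (LinearMap.quotKerEquivRange _)

variable (k : Type u) [Field k] [Algebra k A] [FiniteDimensional k A]
  {P₁ P₀ : Type u} [AddCommGroup P₁] [Module A P₁] [AddCommGroup P₀] [Module A P₀]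
  {d : P₁ →ₗ[A] P₀} [Module.Projective A P₁]

/-- A TF-admissible sequence of relatively projective indecomposable modules in the torsion class
of `d` that generates the classes of the indecomposable projective modules has as many members as
there are indecomposable projective modules. -/
theorem card_eq_of_mem_span [IsNoetherianRing A] [IsArtinianRing A] {n : ℕ}
    {P : Fin n → ModuleCat.{u} A}
    [∀ i, Module.Finite A (P i)] [∀ i, Module.Projective A (P i)] (hP : ∀ i, IsIndec A (P i))
    (hne : ∀ i j, i ≠ j → IsEmpty (P i ≅ P j)) {ι : Type} [Finite ι] {σ : ι → Fin n}
    (φ : A ≃ₗ[A] ∀ j, P (σ j))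
    (hsinc : ∀ i, ∃ (X : ModuleCat.{u} A) (g : P i →ₗ[A] X), Module.Finite A X ∧ Extends d X ∧
      g ≠ 0) {s : ℕ} {M : Fin s → ModuleCat.{u} A} [∀ i, Module.Finite A (M i)]
    (hM : ∀ i, Extends d (M i)) (hM' : ∀ i, ExtProj d (M i))
    (hF : ∀ i, ¬ Fac (tailSum M i) (M i))
    (hspan : ∀ i, (fun X : TorsionClass d => homDim k (P i) X.1) ∈
      Submodule.span ℚ (Set.range fun j (X : TorsionClass d) => homDim k (M j) X.1)) :
    s = n := by
  have hloc := fun i => (hP i).isLocalRing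
  have hex : ∀ i, ∃ (X : TorsionClass d) (g : P i →ₗ[A] X.1), IsCoatom (LinearMap.ker g) := by
    intro i
    obtain ⟨X, g, hXf, hX, hg⟩ := hsinc i
    obtain ⟨Y, g', hYf, hY, hg'⟩ := exists_isCoatom_ker hX hg
    exact ⟨⟨Y, hYf, hY⟩, g', hg'⟩
  choose X g hg using hex
  have := fun i => (X i).2.1
  let C (i : Fin n) : TorsionClass d := ⟨ModuleCat.of A ((X i).1 ⧸ LinearMap.range (g i)),
    inferInstance, (X i).2.2.of_surjective _ (Submodule.mkQ_surjective _)⟩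
  -- The coordinate `f (X i) - f (C i)` plays the role of the value of `f` at the simple top of `P
  -- i`, which itself need not lie in the torsion class.
  let Φ : (TorsionClass d → ℚ) →ₗ[ℚ] (Fin n → ℚ) :=
    LinearMap.pi fun i => LinearMap.proj (R := ℚ) (φ := fun _ => ℚ) (X i) -
      LinearMap.proj (R := ℚ) (φ := fun _ => ℚ) (C i)
  let e (j : Fin s) (X : TorsionClass d) : ℚ := homDim k (M j) X.1
  have hΦ : ∀ l i, Φ (fun X => homDim k (P l) X.1) i =
      homDim k (P l) (ModuleCat.of A (LinearMap.range (g i))) := fun l i => by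
    have h : homDim k (P l) (X i).1 = homDim k (P l) (ModuleCat.of A (LinearMap.range (g i))) +
        homDim k (P l) (C i).1 := homDim_eq_add_of_lift k (LinearMap.range (g i)).subtype
      (Submodule.injective_subtype _) (LinearMap.range (g i)).mkQ (by
        rw [Submodule.ker_mkQ, Submodule.range_subtype])
      fun f => Module.projective_lifting_property _ f (Submodule.mkQ_surjective _)
    change homDim k (P l) (X i).1 - homDim k (P l) (C i).1 = _
    linarith
  have hoff : ∀ l i, l ≠ i → Φ (fun X => homDim k (P l) X.1) i = 0 := fun l i hli => by
    rw [hΦ]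
    exact homDim_eq_zero k fun f => eq_zero_of_isCoatom_ker (hP i) (hP l)
      ⟨fun ψ => (hne i l hli.symm).elim ψ.toModuleIso⟩ (g i) (hg i) f
  have hdiag : ∀ i, Φ (fun X => homDim k (P i) X.1) i ≠ 0 := fun i => by
    rw [hΦ]
    refine homDim_ne_zero k (f := (g i).rangeRestrict) fun h => (hg i).1 ?_
    rw [← LinearMap.ker_rangeRestrict, h, LinearMap.ker_zero]
  -- Noetherian induction on quotients `D` of `Y`: a simple submodule `S` of `D` is the top of some
  -- `P i`, and `f D - f (D ⧸ S)` equals the coordinate `Φ f i = 0`.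
  have hzero : ∀ f : TorsionClass d → ℚ, IsAdditive f → Φ f = 0 → f = 0 := by
    intro f hf hΦf
    funext Y
    have := Y.2.1
    suffices H : ∀ (L : Submodule A Y.1) (D : TorsionClass d) (q : Y.1 →ₗ[A] D.1),
        Function.Surjective q → LinearMap.ker q = L → f D = 0 from
      H _ Y LinearMap.id Function.surjective_id rfl
    intro L
    induction L using WellFoundedGT.induction with
    | ind L ih =>
    rintro D q hq rfl
    have := D.2.1
    by_cases hD : Nontrivial D.1
    swap
    · rw [not_nontrivial_iff_subsingleton] at hD
      exact hf.eq_zero D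
    obtain ⟨i, g', ha, hc⟩ := exists_isAtom_range φ D.1
    let S := LinearMap.range g'
    let D' : TorsionClass d := ⟨ModuleCat.of A (D.1 ⧸ S), inferInstance,
      D.2.2.of_surjective _ (Submodule.mkQ_surjective _)⟩
    have h0 : f D' = 0 := by
      refine ih _ ?_ D' (S.mkQ ∘ₗ q) ((Submodule.mkQ_surjective _).comp hq) rfl
      rw [LinearMap.ker_comp, Submodule.ker_mkQ]
      refine lt_of_le_of_ne (Submodule.comap_mono bot_le) fun h => ha.1 ?_
      exact (Submodule.comap_injective_of_surjective hq h).symm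
    have h1 := hf.add_eq_add (X := D) (C := D') (X' := X i) (C' := C i) g' (g i)
      (eq_of_isCoatom hc (hg i)) S.mkQ S.mkQ_surjective S.ker_mkQ.symm
      (LinearMap.range (g i)).mkQ (Submodule.mkQ_surjective _) (Submodule.ker_mkQ _).symm
    have h2 : f (X i) - f (C i) = 0 := congrFun hΦf i
    linarith
  apply le_antisymm
  · have hli : LinearIndependent ℚ fun j => Φ (e j) := by
      rw [Fintype.linearIndependent_iff]
      intro c hc
      have h0 : ∑ j, c j • e j = 0 := hzero _
        (IsAdditive.sum_smul (fun j => isAdditive_homDim k (hM' j)) c) (by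
          rw [map_sum, ← hc]
          simp only [map_smul])
      intro i
      induction i using WellFoundedLT.induction with
      | ind i ih =>
      -- Triangularity: at `Δ(i)` the terms `j > i` vanish, those with `j < i` have zero coefficient
      -- by induction, and `Hom(M i, Δ(i)) ≠ 0`.
      have h1 := congrFun h0 ⟨Delta M i, inferInstance, extends_delta hM i⟩
      simp only [Finset.sum_apply, Pi.smul_apply, smul_eq_mul, Pi.zero_apply] at h1
      rw [Finset.sum_eq_single i (fun j _ hji => ?_)
        (fun hi => absurd (Finset.mem_univ i) hi)] at h1
      · refine (mul_eq_zero.1 h1).resolve_right (homDim_ne_zero k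
          (f := (torsionPart (Fac (tailSum M i)) (M i)).mkQ) fun h => ?_)
        have := nontrivial_delta hF i
        rw [Submodule.Quotient.nontrivial_iff] at this
        rw [← LinearMap.ker_eq_top, Submodule.ker_mkQ] at h
        exact this h
      · rcases lt_or_gt_of_ne hji with hlt | hlt
        · rw [ih j hlt, zero_mul]
        · have : e j ⟨Delta M i, inferInstance, extends_delta hM i⟩ = 0 :=
            homDim_eq_zero k (hom_delta_eq_zero hM hM' hlt)
          rw [this, mul_zero]
    simpa using hli.fintype_card_le_finrank
  · have htop : Submodule.span ℚ (Set.range fun j => Φ (e j)) = ⊤ := by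
      rw [eq_top_iff, ← (Pi.basisFun ℚ (Fin n)).span_eq, Submodule.span_le]
      rintro _ ⟨i, rfl⟩
      have h1 := Submodule.mem_map_of_mem (f := Φ) (hspan i)
      rw [Submodule.map_span, ← Set.range_comp] at h1
      have h2 : Pi.basisFun ℚ (Fin n) i = (Φ (fun X => homDim k (P i) X.1) i)⁻¹ •
          Φ (fun X => homDim k (P i) X.1) := by
        ext j
        by_cases hij : i = j
        · subst hij
          simp [inv_mul_cancel₀ (hdiag i)]
        · simp [hoff i j hij, hij]
      rw [SetLike.mem_coe, h2]
      exact Submodule.smul_mem _ _ h1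
    have := finrank_range_le_card (R := ℚ) (fun j => Φ (e j))
    rw [Set.finrank, htop] at this
    simpa using this

end Count

/-! ### The rank as a count of isomorphism classes in a decomposition. -/

section Rank

variable {A : Type u} [Ring A]

theorem exists_equiv_prod_of_retract {X Z : ModuleCat.{u} A} (s : X →ₗ[A] Z) (r : Z →ₗ[A] X)
    (h : r ∘ₗ s = LinearMap.id) : ∃ Y : ModuleCat.{u} A, Nonempty (Z ≃ₗ[A] (X × Y)) := by
  have hrs : ∀ x, r (s x) = x := fun x => LinearMap.congr_fun h x
  refine ⟨ModuleCat.of A (LinearMap.ker r), ⟨LinearEquiv.ofLinearMap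
    (r.prod ((LinearMap.id - s ∘ₗ r).codRestrict _ fun z => by simp [hrs]))
    (s.coprod (LinearMap.ker r).subtype) ?_ ?_⟩⟩
  · apply LinearMap.ext
    rintro ⟨x, y, hy⟩
    have hy' : r y = 0 := hy
    refine Prod.ext ?_ (Subtype.ext ?_)
    · simp [hrs, hy']
    · simp [hrs, hy']
  · ext z
    simp

theorem exists_retract_of_equiv_pi {ι : Type} {X : Type u} [AddCommGroup X] [Module A X]
    {Y : ι → ModuleCat.{u} A} (φ : X ≃ₗ[A] ∀ j, Y j) (j : ι) :
    ∃ (s : Y j →ₗ[A] X) (r : X →ₗ[A] Y j), r ∘ₗ s = LinearMap.id := by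
  classical
  exact ⟨φ.symm.toLinearMap ∘ₗ LinearMap.single A (fun j => (Y j : Type u)) j,
    LinearMap.proj j ∘ₗ φ.toLinearMap, by ext; simp⟩

theorem finite_of_equiv_pi {ι : Type} {X : Type u} [AddCommGroup X] [Module A X] [Module.Finite A X]
    {Y : ι → ModuleCat.{u} A} (φ : X ≃ₗ[A] ∀ j, Y j) (j : ι) : Module.Finite A (Y j) := by
  obtain ⟨s, r, h⟩ := exists_retract_of_equiv_pi φ j
  exact Module.Finite.of_surjective r fun x => ⟨s x, LinearMap.congr_fun h x⟩

theorem rk_eq_ncard_range [IsNoetherianRing A] [IsArtinianRing A] {X : ModuleCat.{u} A}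
    [Module.Finite A X] {ι : Type} [Fintype ι] {Y : ι → ModuleCat.{u} A}
    (hY : ∀ j, IsIndec A (Y j)) (φ : X ≃ₗ[A] ∀ j, Y j) :
    rk X = (Set.range fun j =>
      (Quotient.mk (isIsomorphicSetoid (ModuleCat.{u} A)) (Y j))).ncard := by
  refine congrArg Set.ncard (Set.ext fun c => ⟨?_, ?_⟩)
  · rintro ⟨Z, rfl, hZ, W, ⟨ψ⟩⟩
    have : Module.Finite A Z := Module.Finite.of_surjective
      (LinearMap.fst A Z W ∘ₗ ψ.toLinearMap)
      ((LinearMap.fst_surjective (R := A) (M := Z) (M₂ := W)).comp ψ.surjective)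
    obtain ⟨j, ⟨e⟩⟩ := (isIndec_of_indecomposable hZ).exists_equiv_of_retract_pi hY
      (φ.toLinearMap ∘ₗ ψ.symm.toLinearMap ∘ₗ LinearMap.inl A Z W)
      (LinearMap.fst A Z W ∘ₗ ψ.toLinearMap ∘ₗ φ.symm.toLinearMap) (by ext; simp)
    exact ⟨j, Quotient.sound ⟨e.symm.toModuleIso⟩⟩
  · rintro ⟨j, rfl⟩
    obtain ⟨s, r, h⟩ := exists_retract_of_equiv_pi φ j
    exact ⟨Y j, rfl, indecomposable_of_isIndec (hY j), exists_equiv_prod_of_retract s r h⟩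

end Rank

/-! ### Prepending modules to a sequence. -/

section Append

variable {A : Type u} [Ring A]

theorem Fac.mono {U U' : ModuleCat.{u} A} (f : U' →ₗ[A] U) (hf : Function.Surjective f)
    {X : ModuleCat.{u} A} (hX : Fac U X) : Fac U' X := by
  obtain ⟨hXf, n, g, hg⟩ := hX
  refine ⟨hXf, n, g ∘ₗ LinearMap.pi fun i => f ∘ₗ LinearMap.proj i, hg.comp fun y => ?_⟩
  choose x hx using fun i => hf (y i)
  exact ⟨x, funext hx⟩

theorem fac_congr {U U' : ModuleCat.{u} A} (φ : U ≃ₗ[A] U') : Fac U = Fac U' := by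
  funext X
  exact propext ⟨Fac.mono φ.symm.toLinearMap φ.symm.surjective,
    Fac.mono φ.toLinearMap φ.surjective⟩

variable {r t : ℕ} (N : Fin r → ModuleCat.{u} A) (M : Fin t → ModuleCat.{u} A)

/-- The concatenation of two finite sequences of modules. -/
def appendModules : Fin (r + t) → ModuleCat.{u} A := Fin.append N M

theorem appendModules_castAdd (i : Fin r) : appendModules N M (Fin.castAdd t i) = N i :=
  Fin.append_left N M i

theorem appendModules_natAdd (i : Fin t) : appendModules N M (Fin.natAdd r i) = M i :=
  Fin.append_right N M i

theorem fac_tailSum_append (i : Fin t) :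
    Fac (tailSum (appendModules N M) (Fin.natAdd r i)) = Fac (tailSum M i) := by
  have ψ (j : Fin t) : appendModules N M (Fin.natAdd r j) ≃ₗ[A] M j :=
    (eqToIso (appendModules_natAdd N M j)).toLinearEquiv
  let e : {j : Fin t // i < j} ≃ {j : Fin (r + t) // Fin.natAdd r i < j} :=
    Equiv.ofBijective (fun j => ⟨Fin.natAdd r j, by simpa using j.2⟩) (by
      refine ⟨fun j j' h => ?_, ?_⟩
      · simpa [Subtype.ext_iff] using h
      · rintro ⟨j, hj⟩
        induction j using Fin.addCases with
        | left j => simp [Fin.lt_def] at hj; omega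
        | right j => exact ⟨⟨j, by simpa using hj⟩, rfl⟩)
  exact fac_congr ((LinearEquiv.piCongrLeft A (fun j : {j : Fin (r + t) // Fin.natAdd r i < j} =>
    (appendModules N M j : Type u)) e).symm.trans
      (LinearEquiv.piCongrRight fun j => ψ j))

/-- The completed system must agree with `Δ_M` on the nose. Isomorphic tails have equal `Fac`, so
the torsion-free parts are equal and not merely isomorphic. -/
theorem torsionFreePart_congr {T T' : ObjectProperty (ModuleCat.{u} A)} (hT : T = T')
    {X X' : ModuleCat.{u} A} (hX : X = X') : torsionFreePart T X = torsionFreePart T' X' := by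
  subst hT hX
  rfl

theorem delta_append (i : Fin t) : Delta (appendModules N M) (Fin.natAdd r i) = Delta M i :=
  torsionFreePart_congr (fac_tailSum_append N M i) (appendModules_natAdd N M i)

/-- The product of `M` is a direct summand of every tail of `appendModules N M` that contains `M`. -/
theorem exists_retract_tailSum_append (a : Fin r) :
    ∃ (s : (∀ i, M i) →ₗ[A] tailSum (appendModules N M) (Fin.castAdd t a))
      (q : tailSum (appendModules N M) (Fin.castAdd t a) →ₗ[A] ∀ i, M i),
      q ∘ₗ s = LinearMap.id := by
  classical
  have ψ (j : Fin t) : appendModules N M (Fin.natAdd r j) ≃ₗ[A] M j :=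
    (eqToIso (appendModules_natAdd N M j)).toLinearEquiv
  let σ (j : Fin t) : {j : Fin (r + t) // Fin.castAdd t a < j} :=
    ⟨Fin.natAdd r j, by simp [Fin.lt_def]; omega⟩
  have hσ : Function.Injective σ := fun j j' h => by
    simpa [σ] using h
  let U (j : {j : Fin (r + t) // Fin.castAdd t a < j}) : Type u := appendModules N M j
  refine ⟨∑ j, LinearMap.single A U (σ j) ∘ₗ (ψ j).symm.toLinearMap ∘ₗ LinearMap.proj j,
    LinearMap.pi fun j => (ψ j).toLinearMap ∘ₗ LinearMap.proj (σ j), LinearMap.ext fun x => ?_⟩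
  funext j
  have h : (∑ l, LinearMap.single A U (σ l) ((ψ l).symm (x l))) (σ j) = (ψ j).symm (x j) := by
    rw [Finset.sum_apply, Finset.sum_eq_single j (fun l _ hl => ?_)
      (fun hj => absurd (Finset.mem_univ j) hj)]
    · simp
    · simp [Pi.single_eq_of_ne (hσ.ne hl.symm)]
  have h' : ψ j ((∑ l, LinearMap.single A U (σ l) ((ψ l).symm (x l))) (σ j)) = x j := by
    rw [h, LinearEquiv.apply_symm_apply]
  simpa [LinearMap.sum_apply] using h'

end Append

/-! ### The completion of a TF-admissible decomposition. -/

section Main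

variable {A : Type u} [Ring A]

theorem MinProjPresentation.extProj {M : ModuleCat.{u} A} (p : MinProjPresentation M) :
    ExtProj p.d M := by
  have := p.projective₀
  exact ExtProj.of_presentation p.d p.π p.surjective_π p.exact fun _ _ _ h => h

/-- A TF-admissible decomposition of a `τ`-rigid module extends to a TF-admissible sequence of
length `rk A` in the torsion class `{X | Extends d X}`. -/
theorem MinProjPresentation.exists_completion (k : Type u) [Field k] [Algebra k A]
    [FiniteDimensional k A] {M : ModuleCat.{u} A} [Module.Finite A M]
    (p : MinProjPresentation M) (hM : Extends p.d M) {t : ℕ} {Mi : Fin t → ModuleCat.{u} A}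
    (hTF : IsTFAdmissible M Mi) :
    ∃ (r : ℕ) (N : Fin r → ModuleCat.{u} A), r + t = rk (ModuleCat.of A A) ∧
      ∀ i, Module.Finite A (appendModules N Mi i) ∧ Extends p.d (appendModules N Mi i) ∧
        ExtProj p.d (appendModules N Mi i) ∧ IsIndec A (appendModules N Mi i) ∧
        ¬ Fac (tailSum (appendModules N Mi) i) (appendModules N Mi i) := by
  classical
  have : IsNoetherianRing A := IsNoetherianRing.of_finite k A
  have : IsArtinianRing A := IsArtinianRing.of_finite k A
  have := p.projective₁
  obtain ⟨φM⟩ := hTF.decomposition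
  have hMf := finite_of_equiv_pi φM
  have hMi := fun i => isIndec_of_indecomposable (hTF.indecomposable i)
  obtain ⟨κ, _, Y, hY, ⟨φA⟩⟩ := exists_indecomposable_decomposition (ModuleCat.of A A)
  obtain ⟨n, ρ, hρ, hρ', hn⟩ := exists_representatives Y
  rw [← rk_eq_ncard_range hY φA] at hn
  choose σ hσ using hρ'
  let P (i : Fin n) := Y (ρ i)
  have hPf : ∀ i, Module.Finite A (P i) := fun i =>
    finite_of_equiv_pi (X := ModuleCat.of A A) φA (ρ i)
  have hPp : ∀ i, Module.Projective A (P i) := fun i => by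
    obtain ⟨s, q, h⟩ := exists_retract_of_equiv_pi (X := ModuleCat.of A A) φA (ρ i)
    have : Module.Projective A (ModuleCat.of A A) := inferInstanceAs (Module.Projective A A)
    exact Module.Projective.of_split s q h
  choose E m ιE qE hEf hE hE' hqE hιq hιE hE0 using
    fun i => p.exists_universal_extension k hM (P i)
  choose I hI Z hZ hφE using fun i => exists_indecomposable_decomposition (E i)
  have φE := fun i => (hφE i).some
  let J := {x : Σ i, I i // ∀ j, IsEmpty (Z x.1 x.2 ≅ Mi j)}
  obtain ⟨r, θ, hθ, hθ', -⟩ := exists_representatives fun x : J => Z x.1.1 x.1.2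
  let N (a : Fin r) := Z (θ a).1.1 (θ a).1.2
  have hall : ∀ i, Module.Finite A (appendModules N Mi i) ∧ Extends p.d (appendModules N Mi i) ∧
      ExtProj p.d (appendModules N Mi i) ∧ IsIndec A (appendModules N Mi i) := by
    intro i
    induction i using Fin.addCases with
    | left a =>
      rw [appendModules_castAdd]
      obtain ⟨s, q, h⟩ := exists_retract_of_equiv_pi (φE (θ a).1.1) (θ a).1.2
      exact ⟨finite_of_equiv_pi (φE (θ a).1.1) (θ a).1.2,
        (hE _).of_surjective q fun x => ⟨s x, LinearMap.congr_fun h x⟩,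
        (hE' _).of_retract s q h, hZ _ _⟩
    | right i =>
      rw [appendModules_natAdd]
      obtain ⟨s, q, h⟩ := exists_retract_of_equiv_pi φM i
      exact ⟨hMf i, hM.of_surjective q fun x => ⟨s x, LinearMap.congr_fun h x⟩,
        p.extProj.of_retract s q h, hMi i⟩
  have hfin := fun i => (hall i).1
  have hF : ∀ i, ¬ Fac (tailSum (appendModules N Mi) i) (appendModules N Mi i) := by
    intro i
    induction i using Fin.addCases with
    | left a =>
      intro hFac
      -- The tail after `N a` contains `M`, so `N a`, if generated by it, is a summand of one of its
      -- powers. By Krull-Schmidt `N a` is then isomorphic to a later term, against the choice of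
      -- representatives.
      obtain ⟨s, q, h⟩ := exists_retract_tailSum_append N Mi a
      obtain ⟨l, s', q', h'⟩ := p.exists_retract_of_fac k (hall _).2.2.1
        (extends_tailSum (fun i => (hall i).2.1) _) (s ∘ₗ φM.toLinearMap)
        (φM.symm.toLinearMap ∘ₗ q) (LinearMap.ext fun x => by
          have := LinearMap.congr_fun h (φM x)
          simp only [LinearMap.comp_apply, LinearMap.id_apply] at this
          simp [this]) hFac
      have := (hall (Fin.castAdd t a)).2.2.2.isLocalRing
      obtain ⟨-, s₂, q₂, h₂⟩ := exists_retract_of_retract_pi s' q' h'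
      obtain ⟨⟨j, hj⟩, ⟨e⟩⟩ := (hall (Fin.castAdd t a)).2.2.2.exists_equiv_of_retract_pi
        (U := fun j : {j // Fin.castAdd t a < j} => appendModules N Mi j)
        (fun j => (hall j).2.2.2) s₂ q₂ h₂
      have e' := e.toModuleIso
      induction j using Fin.addCases with
      | left b =>
        have e₂ : N a ≅ N b := eqToIso (appendModules_castAdd N Mi a).symm ≪≫ e' ≪≫
          eqToIso (appendModules_castAdd N Mi b)
        have hab : a ≠ b := fun hab => by
          subst hab
          exact lt_irrefl _ hj
        exact (hθ a b hab).elim e₂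
      | right b =>
        have e₂ : N a ≅ Mi b := eqToIso (appendModules_castAdd N Mi a).symm ≪≫ e' ≪≫
          eqToIso (appendModules_natAdd N Mi b)
        exact ((θ a).2 b).elim e₂
    | right i =>
      rw [fac_tailSum_append, appendModules_natAdd]
      exact hTF.not_fac i
  refine ⟨r, N, ?_, fun i => ⟨(hall i).1, (hall i).2.1, (hall i).2.2.1, (hall i).2.2.2, hF i⟩⟩
  rw [← hn]
  refine card_eq_of_mem_span k (d := p.d) (P := P) (σ := σ) (fun i => hY _) hρ
    ((φA : A ≃ₗ[A] _).trans (LinearEquiv.piCongrRight fun j => (hσ j).some.toLinearEquiv))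
    -- The torsion class is sincere: `P i → E i` is a nonzero map into it.
    (fun i => ⟨E i, ιE i, hEf i, hE i, hE0 i (hY _).isLocalRing⟩)
    (fun i => (hall i).2.1) (fun i => (hall i).2.2.1) hF fun i => ?_
  have hmem : ∀ j, (fun X : TorsionClass p.d => homDim k (appendModules N Mi j) X.1) ∈
      Submodule.span ℚ (Set.range fun j (X : TorsionClass p.d) =>
        homDim k (appendModules N Mi j) X.1) := fun j => Submodule.subset_span ⟨j, rfl⟩
  have hmemM : ∀ j, (fun X : TorsionClass p.d => homDim k (Mi j) X.1) ∈
      Submodule.span ℚ (Set.range fun j (X : TorsionClass p.d) =>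
        homDim k (appendModules N Mi j) X.1) := fun j => by
    have := hmem (Fin.natAdd r j)
    rwa [appendModules_natAdd] at this
  have hmemN : ∀ j, (fun X : TorsionClass p.d => homDim k (N j) X.1) ∈
      Submodule.span ℚ (Set.range fun j (X : TorsionClass p.d) =>
        homDim k (appendModules N Mi j) X.1) := fun j => by
    have := hmem (Fin.castAdd t j)
    rwa [appendModules_castAdd] at this
  have hmemZ : ∀ x, (fun X : TorsionClass p.d => homDim k (Z i x) X.1) ∈
      Submodule.span ℚ (Set.range fun j (X : TorsionClass p.d) =>
        homDim k (appendModules N Mi j) X.1) := fun x => by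
    by_cases hx : ∃ j, Nonempty (Z i x ≅ Mi j)
    · obtain ⟨j, ⟨e⟩⟩ := hx
      simp only [homDim_congr_left k e.toLinearEquiv]
      exact hmemM j
    · simp only [not_exists, not_nonempty_iff] at hx
      obtain ⟨a, ⟨e⟩⟩ := hθ' ⟨⟨i, x⟩, hx⟩
      simp only [homDim_congr_left k e.toLinearEquiv]
      exact hmemN a
  have hZf := fun x => finite_of_equiv_pi (φE i) x
  -- On the torsion class maps `P i → X` extend to `E i`, so `Hom(-, X)` is exact on `P i → E i →
  -- M^m → 0`, with zero on the left of `Hom(M^m, X)` and on the right of `Hom(P i, X)`.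
  have heq : (fun X : TorsionClass p.d => homDim k (P i) X.1) =
      ∑ x, (fun X : TorsionClass p.d => homDim k (Z i x) X.1) -
        (m i : ℚ) • ∑ j, fun X : TorsionClass p.d => homDim k (Mi j) X.1 := by
    funext X
    have := X.2.1
    have h1 := homDim_eq_add_of_extend k (C := ModuleCat.of A (Fin (m i) → M)) (X := X.1)
      (ιE i) (qE i) (hqE i) (hιq i) (hιE i X.1 X.2.2)
    rw [homDim_congr_left k (N' := ModuleCat.of A (∀ x, Z i x)) (φE i), homDim_pi,
      homDim_pi k (fun _ : Fin (m i) => M),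
      homDim_congr_left k (N := M) (N' := ModuleCat.of A (∀ j, Mi j)) φM, homDim_pi] at h1
    simp only [Finset.sum_const, Finset.card_univ, Fintype.card_fin, nsmul_eq_mul] at h1
    simp only [Pi.sub_apply, Finset.sum_apply, Pi.smul_apply, smul_eq_mul]
    linarith
  rw [heq]
  exact Submodule.sub_mem _ (Submodule.sum_mem _ fun x _ => hmemZ x)
    (Submodule.smul_mem _ _ (Submodule.sum_mem _ fun j _ => hmemM j))

end Main

end TauStrat

open TauStrat in
theorem theorem3p3 {k A : Type u} [Field k] [Ring A] [Nontrivial A] [Algebra k A]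
    [FiniteDimensional k A] (n : ℕ) (hn : rk (ModuleCat.of A A) = n)
    (M : ModuleCat.{u} A) [Module.Finite A M] [Nontrivial M] (hbasic : IsBasic M)
    (hrigid : IsTauRigid k M) (t : ℕ) (Mi : Fin t → ModuleCat.{u} A)
    (hTF : IsTFAdmissible M Mi) :
    (∀ i : Fin t, IsTorsionPair (Fac (tailSum Mi i)) (rightPerp (tailSum Mi i))) ∧
    IsStratifyingSystem (Delta Mi) ∧
    ∃ (htn : t ≤ n) (Δ' : Fin n → ModuleCat.{u} A), IsStratifyingSystem Δ' ∧
      ∀ i : Fin t, Δ' ⟨n - t + i, by omega⟩ = Delta Mi i := by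
  obtain ⟨p, hp⟩ := hrigid
  have hM := p.extends_of_hom_tau_eq_zero k hp
  have : IsNoetherianRing A := IsNoetherianRing.of_finite k A
  have : IsArtinianRing A := IsArtinianRing.of_finite k A
  have := p.projective₁
  obtain ⟨φM⟩ := hTF.decomposition
  have hMf := finite_of_equiv_pi φM
  have hext : ∀ i, Extends p.d (Mi i) := fun i => by
    obtain ⟨s, q, h⟩ := exists_retract_of_equiv_pi φM i
    exact hM.of_surjective q fun x => ⟨s x, LinearMap.congr_fun h x⟩
  have hproj : ∀ i, ExtProj p.d (Mi i) := fun i => by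
    obtain ⟨s, q, h⟩ := exists_retract_of_equiv_pi φM i
    exact p.extProj.of_retract s q h
  refine ⟨fun i => isTorsionPair_fac (extends_tailSum hext i) (extProj_tailSum hproj i),
    isStratifyingSystem_delta hext hproj
      (fun i => isIndec_of_indecomposable (hTF.indecomposable i)) hTF.not_fac, ?_⟩
  obtain ⟨r, N, hr, hN⟩ := p.exists_completion k hM hTF
  -- With `n = r + t` the index `n - t + i` is `Fin.natAdd r i`.
  obtain rfl : r + t = n := hr.trans hn
  have := fun i => (hN i).1
  refine ⟨Nat.le_add_left t r, Delta (appendModules N Mi), isStratifyingSystem_delta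
    (fun i => (hN i).2.1) (fun i => (hN i).2.2.1) (fun i => (hN i).2.2.2.1)
    (fun i => (hN i).2.2.2.2), fun i => ?_⟩
  rw [← delta_append N Mi i]
  congr 1
  ext
  simp
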